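/- Let $n\ge 0$ and let $V\colon\mathbb R^n\to\mathbb R$ be a $\mathcal C^2$ function such that $\mu(dx)=e^{-V(x)}\,dx$ is a probability measure. Assume that $\mu$ satisfies the Poincaré inequality with constant $C_P$, i.e. $\mathrm{var}_\mu(f)\le C_P\int_{\mathbb R^n}|\nabla f|^2\,d\mu$ for every locally Lipschitz function $f\colon\mathbb R^n\to\mathbb R$, and that $V$ is semi-convex with constant $\kappa\ge 0$, i.e. $x\mapsto V(x)+\frac{\kappa}{2}|x|^2$ is convex on $\mathbb R^n$. Let $L_\mu$ be the unique self-adjoint extension on $L^2(\mu)$ of the operator $\varphi\mapsto\Delta\varphi-\langle\nabla\varphi,\nabla V\rangle$ defined on $\mathcal C^\infty$ compactly supported functions (equivalently, as this operator is essentially self-adjoint, the adjoint of that operator). Then every $f$ in the domain of $L_\mu$ has a weak Hessian $\nabla^2 f$, with entries in $L^2(\mu)$, and $$\int_{\mathbb R^n}\|\nabla^2 f\|_F^2\,d\mu\;\le\;(1+\kappa C_P)\int_{\mathbb R^n}(L_\mu f)^2\,d\mu,$$ where $\|A\|_F=\big(\sum_{i,j}a_{ij}^2\big)^{1/2}$ is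 the Frobenius norm. -/

import Mathlib

open MeasureTheory ProbabilityTheory Laplacian Gradient
open scoped ContDiff

noncomputable section

/-- The measure `e^{-V(x)} dx` on `ℝⁿ`. -/
def gibbsMeasure {n : ℕ} (V : EuclideanSpace ℝ (Fin n) → ℝ) :
    Measure (EuclideanSpace ℝ (Fin n)) :=
  volume.withDensity fun x => ENNReal.ofReal (Real.exp (-V x))

/-- The Poincaré inequality with constant `C`: `var_μ f ≤ C ∫ |∇f|² dμ` for every locally Lipschitz
`f` (whose gradient exists almost everywhere). Both sides take values in `[0, ∞]`, so that nothing
is claimed about `f` when the energy is infinite. -/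
def SatisfiesPoincare {n : ℕ} (μ : Measure (EuclideanSpace ℝ (Fin n))) (C : ℝ) : Prop :=
  ∀ f : EuclideanSpace ℝ (Fin n) → ℝ, LocallyLipschitz f →
    evariance f μ ≤ ENNReal.ofReal C * ∫⁻ x, ‖∇ f x‖ₑ ^ 2 ∂μ

/-- `V` is semi-convex with constant `κ`: the function `V + (κ/2)|x|²` is convex. -/
def IsSemiConvex {n : ℕ} (V : EuclideanSpace ℝ (Fin n) → ℝ) (κ : ℝ) : Prop :=
  ConvexOn ℝ Set.univ fun x => V x + κ / 2 * ‖x‖ ^ 2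

/-- The space of smooth compactly supported real functions on `ℝⁿ`. -/
def smoothCompact (n : ℕ) : Submodule ℝ (EuclideanSpace ℝ (Fin n) → ℝ) where
  carrier := {φ | ContDiff ℝ ∞ φ ∧ HasCompactSupport φ}
  zero_mem' := ⟨contDiff_const, HasCompactSupport.zero⟩
  add_mem' := fun hf hg => ⟨hf.1.add hg.1, hf.2.add hg.2⟩
  smul_mem' := fun c _ hf => ⟨contDiff_const.smul hf.1, hf.2.smul_left (f := fun _ => c)⟩

/-- The differential expression `Δφ - ⟨∇φ, ∇V⟩`. -/
def weightedLaplacian {n : ℕ} (V φ : EuclideanSpace ℝ (Fin n) → ℝ)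
    (x : EuclideanSpace ℝ (Fin n)) : ℝ :=
  (Δ φ) x - inner ℝ (∇ φ x) (∇ V x)

section Core

variable {n : ℕ} {V : EuclideanSpace ℝ (Fin n) → ℝ}

theorem isLocallyFiniteMeasure_gibbsMeasure (hV : Continuous V) :
    IsLocallyFiniteMeasure (gibbsMeasure V) :=
  IsLocallyFiniteMeasure.withDensity_ofReal (Real.continuous_exp.comp hV.neg)

theorem volume_absolutelyContinuous_gibbsMeasure (hV : Continuous V) :
    (volume : Measure (EuclideanSpace ℝ (Fin n))) ≪ gibbsMeasure V := by
  refine withDensity_absolutelyContinuous' ?_ ?_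
  · exact (ENNReal.continuous_ofReal.comp (Real.continuous_exp.comp hV.neg)).aemeasurable
  · exact Filter.Eventually.of_forall fun x => by simp [Real.exp_pos]

theorem memLp_gibbsMeasure (hV : Continuous V) {g : EuclideanSpace ℝ (Fin n) → ℝ}
    (hg : Continuous g) (hc : HasCompactSupport g) : MemLp g 2 (gibbsMeasure V) :=
  have := isLocallyFiniteMeasure_gibbsMeasure hV
  hg.memLp_of_hasCompactSupport hc

theorem continuous_gradient {g : EuclideanSpace ℝ (Fin n) → ℝ} (hg : ContDiff ℝ 1 g) :
    Continuous (∇ g) :=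
  (InnerProductSpace.toDual ℝ _).symm.continuous.comp (hg.continuous_fderiv one_ne_zero)

theorem weightedLaplacian_add {φ ψ : EuclideanSpace ℝ (Fin n) → ℝ} (hφ : ContDiff ℝ ∞ φ)
    (hψ : ContDiff ℝ ∞ ψ) :
    weightedLaplacian V (φ + ψ) = weightedLaplacian V φ + weightedLaplacian V ψ := by
  have h2 : (2 : WithTop ℕ∞) ≤ ∞ := WithTop.coe_le_coe.2 (le_top : (2 : ℕ∞) ≤ ⊤)
  ext x
  have h : ∇ (φ + ψ) x = ∇ φ x + ∇ ψ x := by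
    simp [gradient, fderiv_add (hφ.differentiable (by simp) x) (hψ.differentiable (by simp) x)]
  simp only [weightedLaplacian, Pi.add_apply, h, inner_add_left]
  rw [((hφ.of_le h2).contDiffAt).laplacian_add ((hψ.of_le h2).contDiffAt)]
  ring

theorem weightedLaplacian_smul {φ : EuclideanSpace ℝ (Fin n) → ℝ} (hφ : ContDiff ℝ ∞ φ) (c : ℝ) :
    weightedLaplacian V (c • φ) = c • weightedLaplacian V φ := by
  have h2 : (2 : WithTop ℕ∞) ≤ ∞ := WithTop.coe_le_coe.2 (le_top : (2 : ℕ∞) ≤ ⊤)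
  ext x
  have h : ∇ (c • φ) x = c • ∇ φ x := by
    simp [gradient, fderiv_const_smul (hφ.differentiable (by simp) x)]
  simp only [weightedLaplacian, Pi.smul_apply, h, inner_smul_left]
  rw [InnerProductSpace.laplacian_smul c ((hφ.of_le h2).contDiffAt)]
  simp [mul_sub]

theorem memLp_weightedLaplacian (hV : ContDiff ℝ 2 V) {φ : EuclideanSpace ℝ (Fin n) → ℝ}
    (hφ : φ ∈ smoothCompact n) : MemLp (weightedLaplacian V φ) 2 (gibbsMeasure V) := by
  have h2 : (2 : WithTop ℕ∞) ≤ ∞ := WithTop.coe_le_coe.2 (le_top : (2 : ℕ∞) ≤ ⊤)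
  have h1 : (1 : WithTop ℕ∞) ≤ ∞ := WithTop.coe_le_coe.2 (le_top : (1 : ℕ∞) ≤ ⊤)
  refine memLp_gibbsMeasure hV.continuous ?_ ?_
  · refine Continuous.sub ?_ ((continuous_gradient (hφ.1.of_le h1)).inner
      (continuous_gradient (hV.of_le (by norm_num))))
    rw [InnerProductSpace.laplacian_eq_iteratedFDeriv_stdOrthonormalBasis]
    refine continuous_finsetSum _ fun i _ => ?_
    exact (ContinuousMultilinearMap.apply ℝ (fun _ : Fin 2 => EuclideanSpace ℝ (Fin n)) ℝ
      ![stdOrthonormalBasis ℝ _ i, stdOrthonormalBasis ℝ _ i]).continuous.comp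
      (hφ.1.continuous_iteratedFDeriv h2)
  · refine HasCompactSupport.intro hφ.2 fun x hx => ?_
    have hz : φ =ᶠ[nhds x] fun _ => 0 := notMem_tsupport_iff_eventuallyEq.mp hx
    have hl := (InnerProductSpace.laplacian_congr_nhds hz).self_of_nhds
    have hg : ∇ φ x = 0 := by simp [gradient, hz.fderiv_eq]
    simp [weightedLaplacian, hl, hg]

/-- The class in `L²(μ)` of a smooth compactly supported function. -/
def smoothCompactToLp (hV : ContDiff ℝ 2 V) :
    smoothCompact n →ₗ[ℝ] Lp ℝ 2 (gibbsMeasure V) where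
  toFun φ := (memLp_gibbsMeasure hV.continuous φ.2.1.continuous φ.2.2).toLp φ.1
  map_add' _ _ := rfl
  map_smul' _ _ := rfl

theorem smoothCompactToLp_injective (hV : ContDiff ℝ 2 V) :
    Function.Injective (smoothCompactToLp hV) := by
  intro φ ψ h
  have h' : φ.1 =ᵐ[gibbsMeasure V] ψ.1 :=
    (MemLp.toLp_eq_toLp_iff (memLp_gibbsMeasure hV.continuous φ.2.1.continuous φ.2.2)
      (memLp_gibbsMeasure hV.continuous ψ.2.1.continuous ψ.2.2)).mp h
  exact Subtype.ext (Measure.eq_of_ae_eq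
    ((volume_absolutelyContinuous_gibbsMeasure hV.continuous).ae_le h')
    φ.2.1.continuous ψ.2.1.continuous)

/-- The map `φ ↦ Δφ - ⟨∇φ, ∇V⟩` from smooth compactly supported functions to `L²(μ)`. -/
def weightedLaplacianToLp (hV : ContDiff ℝ 2 V) :
    smoothCompact n →ₗ[ℝ] Lp ℝ 2 (gibbsMeasure V) where
  toFun φ := (memLp_weightedLaplacian hV φ.2).toLp (weightedLaplacian V φ.1)
  map_add' φ ψ := by
    rw [← MemLp.toLp_add]
    exact MemLp.toLp_congr _ _ (by
      rw [← weightedLaplacian_add φ.2.1 ψ.2.1]; rfl)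
  map_smul' c φ := by
    rw [RingHom.id_apply, ← MemLp.toLp_const_smul]
    exact MemLp.toLp_congr _ _ (by
      rw [← weightedLaplacian_smul φ.2.1 c]; rfl)

/-- The operator `φ ↦ Δφ - ⟨∇φ, ∇V⟩` as an unbounded operator on `L²(μ)`, `μ = e^{-V} dx`, whose
domain consists of the (classes of) smooth compactly supported functions. -/
def laplaceCore (hV : ContDiff ℝ 2 V) :
    Lp ℝ 2 (gibbsMeasure V) →ₗ.[ℝ] Lp ℝ 2 (gibbsMeasure V) where
  domain := LinearMap.range (smoothCompactToLp hV)
  toFun := weightedLaplacianToLp hV ∘ₗ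
    (LinearEquiv.ofInjective (smoothCompactToLp hV)
      (smoothCompactToLp_injective hV)).symm.toLinearMap

/-- The Laplace operator `L_μ` associated to `μ = e^{-V} dx`, as an unbounded operator on `L²(μ)`:
the adjoint of its restriction to smooth compactly supported functions. That restriction is
essentially self-adjoint, so this is its unique self-adjoint extension; in any case
`le_laplaceOperator` shows that it extends every self-adjoint extension. -/
def laplaceOperator (hV : ContDiff ℝ 2 V) :
    Lp ℝ 2 (gibbsMeasure V) →ₗ.[ℝ] Lp ℝ 2 (gibbsMeasure V) :=
  (laplaceCore hV).adjoint

theorem dense_laplaceCore_domain (hV : ContDiff ℝ 2 V) :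
    Dense ((laplaceCore hV).domain : Set (Lp ℝ 2 (gibbsMeasure V))) := by
  have := isLocallyFiniteMeasure_gibbsMeasure hV.continuous
  rw [Submodule.dense_iff_topologicalClosure_eq_top, Submodule.topologicalClosure_eq_top_iff,
    Submodule.eq_bot_iff]
  intro u hu
  rw [Submodule.mem_orthogonal] at hu
  rw [Lp.eq_zero_iff_ae_eq_zero]
  refine ae_eq_zero_of_integral_contDiff_smul_eq_zero
    ((Lp.memLp u).locallyIntegrable (by norm_num)) fun g hg hc => ?_
  have h := hu _ ⟨⟨g, hg, hc⟩, rfl⟩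
  rw [L2.inner_def] at h
  rw [← h]
  refine integral_congr_ae ?_
  have hco := (memLp_gibbsMeasure hV.continuous hg.continuous hc).coeFn_toLp
  filter_upwards [hco] with x hx
  change _ = inner ℝ (((memLp_gibbsMeasure hV.continuous hg.continuous hc).toLp g :
    Lp ℝ 2 (gibbsMeasure V)) x) (u x)
  rw [hx]
  simp [mul_comm]

theorem le_laplaceOperator (hV : ContDiff ℝ 2 V)
    (A : Lp ℝ 2 (gibbsMeasure V) →ₗ.[ℝ] Lp ℝ 2 (gibbsMeasure V)) (hA : IsSelfAdjoint A)
    (hle : laplaceCore hV ≤ A) : A ≤ laplaceOperator hV := by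
  refine LinearPMap.IsFormalAdjoint.le_adjoint (dense_laplaceCore_domain hV) fun x y => ?_
  have h := LinearPMap.adjoint_isFormalAdjoint hA.dense_domain
  rw [LinearPMap.isSelfAdjoint_def.mp hA] at h
  rw [hle.2 (y := ⟨x, hle.1 x.2⟩) rfl]
  exact h ⟨x, hle.1 x.2⟩ y

end Core

/-- The matrix field `H` is the weak (distributional) Hessian of `f`: its entries are locally
integrable and `∫ f ∂ᵢ∂ⱼφ dx = ∫ Hᵢⱼ φ dx` for every smooth compactly supported `φ`. -/
def HasWeakHessian {n : ℕ} (f : EuclideanSpace ℝ (Fin n) → ℝ)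
    (H : EuclideanSpace ℝ (Fin n) → Matrix (Fin n) (Fin n) ℝ) : Prop :=
  LocallyIntegrable f volume ∧
  ∀ i j, LocallyIntegrable (fun x => H x i j) volume ∧
    ∀ φ ∈ smoothCompact n,
      ∫ x, f x * iteratedFDeriv ℝ 2 φ x
          ![EuclideanSpace.single i (1 : ℝ), EuclideanSpace.single j (1 : ℝ)] =
        ∫ x, H x i j * φ x

/-- The square `‖A‖_F²` of the Frobenius norm. -/
def frobeniusSq {n : ℕ} (A : Matrix (Fin n) (Fin n) ℝ) : ℝ := ∑ i, ∑ j, A i j ^ 2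

end

/-! Write `L` for `weightedLaplacian V`. For a smooth compactly supported `g`, integrating by parts
in `∫ (L g)² dμ` and commuting `∂ᵢ` with `L` gives the Bochner identity `∫ (L g)² = ∫ ‖∇²g‖² + ∫
⟨∇²V ∇g, ∇g⟩`. Semi-convexity means `∇²V ≥ -κ`, so `∫ ‖∇²g‖² ≤ ∫ (L g)² + κ ∫ |∇g|²`. The Poincaré
inequality, applied to `∫ |∇g|² = -∫ (g - m) L g` with `m` the mean of `g`, gives `∫ |∇g|² ≤ C_P ∫
(L g)²`. Together these prove the bound on test functions
(`SatisfiesPoincare.sum_integral_hessian_sq_le`).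

The bound is linear in character: it makes `∂ᵢ∂ⱼ u_k` Cauchy in `L²(μ)` as soon as `L u_k` is
Cauchy. It therefore extends to the whole domain once test functions are known to be a core
(`exists_smoothCompact_tendsto`), and the limits of `∂ᵢ∂ⱼ u_k` form the weak Hessian.

The core property is the analytic half. As `L ≤ 0`, it reduces to density of the range of `L - 1`,
that is, to `h = 0` whenever `h ∈ L²(μ)` is orthogonal to that range. The density `v = h e^{-V}`
then solves `Δv + div (v ∇V) = v` weakly. Formally, testing with `η² h` yields the Caccioppoli bound
`∫ η² h² dμ ≤ c ∫ |∇η|² h² dμ`, and spreading out the cutoff `η` forces `h = 0`. Since `v` is only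
locally `L²`, the test is carried out on mollifications (`integral_cutoff_sq_le`) and the limit is
taken afterwards (`integral_cutoff_sq_le_of_weak`), with no elliptic regularity. -/

/-! ### Coordinate calculus, integration by parts, and the Hessian bound from semi-convexity. -/

section PartialDerivative

variable {n : ℕ}

/-- The `i`-th partial derivative. -/
noncomputable def pderiv (i : Fin n) (g : EuclideanSpace ℝ (Fin n) → ℝ)
    (x : EuclideanSpace ℝ (Fin n)) : ℝ :=
  fderiv ℝ g x (EuclideanSpace.single i 1)

variable {g k : EuclideanSpace ℝ (Fin n) → ℝ} {i j : Fin n} {x : EuclideanSpace ℝ (Fin n)}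

theorem ContDiff.pderiv {m l : WithTop ℕ∞} (hg : ContDiff ℝ m g) (h : l + 1 ≤ m) (i : Fin n) :
    ContDiff ℝ l (pderiv i g) :=
  (hg.fderiv_right h).clm_apply contDiff_const

theorem HasCompactSupport.pderiv (hg : HasCompactSupport g) (i : Fin n) :
    HasCompactSupport (pderiv i g) :=
  hg.fderiv_apply ℝ _

theorem pderiv_add (hg : DifferentiableAt ℝ g x) (hk : DifferentiableAt ℝ k x) :
    pderiv i (fun y => g y + k y) x = pderiv i g x + pderiv i k x := by
  simp [pderiv, fderiv_fun_add hg hk]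

theorem pderiv_sub (hg : DifferentiableAt ℝ g x) (hk : DifferentiableAt ℝ k x) :
    pderiv i (fun y => g y - k y) x = pderiv i g x - pderiv i k x := by
  simp [pderiv, fderiv_fun_sub hg hk]

theorem pderiv_const_smul (c : ℝ) (hg : DifferentiableAt ℝ g x) :
    pderiv i (c • g) x = c * pderiv i g x := by
  simp [pderiv, fderiv_const_smul hg]

theorem pderiv_mul (hg : DifferentiableAt ℝ g x) (hk : DifferentiableAt ℝ k x) :
    pderiv i (fun y => g y * k y) x = g x * pderiv i k x + k x * pderiv i g x := by
  simp [pderiv, fderiv_fun_mul hg hk]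

theorem pderiv_exp (hg : DifferentiableAt ℝ g x) :
    pderiv i (fun y => Real.exp (g y)) x = Real.exp (g x) * pderiv i g x := by
  simp [pderiv, fderiv_exp hg]

theorem pderiv_neg : pderiv i (fun y => -g y) x = -pderiv i g x := by
  simp [pderiv, fderiv_fun_neg]

theorem pderiv_sum {ι : Type*} {s : Finset ι} {G : ι → EuclideanSpace ℝ (Fin n) → ℝ}
    (hG : ∀ a ∈ s, DifferentiableAt ℝ (G a) x) :
    pderiv i (fun y => ∑ a ∈ s, G a y) x = ∑ a ∈ s, pderiv i (G a) x := by
  simp [pderiv, fderiv_fun_sum hG]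

theorem pderiv_pderiv (hg : ContDiff ℝ 2 g) :
    pderiv i (pderiv j g) x =
      fderiv ℝ (fderiv ℝ g) x (EuclideanSpace.single i 1) (EuclideanSpace.single j 1) := by
  have h : DifferentiableAt ℝ (fderiv ℝ g) x :=
    (hg.fderiv_right (m := 1) (by norm_num)).differentiable one_ne_zero x
  change fderiv ℝ (fun y => fderiv ℝ g y (EuclideanSpace.single j 1)) x _ = _
  rw [fderiv_clm_apply h (differentiableAt_const _)]
  simp

theorem pderiv_comm (hg : ContDiff ℝ 2 g) :
    pderiv i (pderiv j g) x = pderiv j (pderiv i g) x := by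
  rw [pderiv_pderiv hg, pderiv_pderiv hg]
  exact (hg.contDiffAt.isSymmSndFDerivAt (by simp)).eq _ _

theorem iteratedFDeriv_two_single (hg : ContDiff ℝ 2 g) :
    iteratedFDeriv ℝ 2 g x ![EuclideanSpace.single i (1 : ℝ), EuclideanSpace.single j (1 : ℝ)] =
      pderiv i (pderiv j g) x := by
  rw [pderiv_pderiv hg, iteratedFDeriv_two_apply]
  simp

theorem gradient_apply (i : Fin n) : (∇ g x) i = pderiv i g x := by
  have h : inner ℝ (∇ g x) (EuclideanSpace.single i (1 : ℝ)) = pderiv i g x := by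
    simp [gradient, pderiv]
  rw [← h, EuclideanSpace.inner_single_right]
  simp

theorem norm_gradient_sq : ‖∇ g x‖ ^ 2 = ∑ i, pderiv i g x ^ 2 := by
  simp [EuclideanSpace.norm_sq_eq, gradient_apply]

theorem weightedLaplacian_eq {V : EuclideanSpace ℝ (Fin n) → ℝ} (hg : ContDiff ℝ 2 g) :
    weightedLaplacian V g x = ∑ i, (pderiv i (pderiv i g) x - pderiv i g x * pderiv i V x) := by
  rw [weightedLaplacian, InnerProductSpace.laplacian_eq_iteratedFDeriv_orthonormalBasis g
    (EuclideanSpace.basisFun (Fin n) ℝ)]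
  simp only [EuclideanSpace.basisFun_apply, iteratedFDeriv_two_single hg, Finset.sum_sub_distrib]
  congr 1
  rw [PiLp.inner_apply]
  simp [gradient_apply, mul_comm]

theorem integral_pderiv_mul (hg : ContDiff ℝ 1 g) (hk : ContDiff ℝ 1 k)
    (hc : HasCompactSupport g) :
    ∫ x, pderiv i g x * k x = -∫ x, g x * pderiv i k x := by
  rw [← neg_eq_iff_eq_neg, eq_comm]
  have hg' := (hg.pderiv (l := 0) (by simp) i).continuous
  have hk' := (hk.pderiv (l := 0) (by simp) i).continuous
  refine integral_mul_fderiv_eq_neg_fderiv_mul_of_integrable ?_ ?_ ?_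
    (fun x _ => hg.differentiable one_ne_zero x) (fun x _ => hk.differentiable one_ne_zero x)
  · exact (hg'.mul hk.continuous).integrable_of_hasCompactSupport (hc.pderiv i).mul_right
  · exact (hg.continuous.mul hk').integrable_of_hasCompactSupport hc.mul_right
  · exact (hg.continuous.mul hk.continuous).integrable_of_hasCompactSupport hc.mul_right

theorem integral_pderiv_eq_zero (hg : ContDiff ℝ 1 g) (hc : HasCompactSupport g) :
    ∫ x, pderiv i g x = 0 := by
  simpa [pderiv] using integral_pderiv_mul (i := i) hg (contDiff_const (c := (1 : ℝ))) hc

/-- Along each line `t ↦ x + t a` the convex function has a monotone derivative, so its second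
derivative at `t = 0`, which is `∇²V(a, a) + κ|a|²`, is nonnegative. -/
theorem IsSemiConvex.le_fderiv_fderiv {V : EuclideanSpace ℝ (Fin n) → ℝ} {κ : ℝ}
    (h : IsSemiConvex V κ) (hV : ContDiff ℝ 2 V) (x a : EuclideanSpace ℝ (Fin n)) :
    -κ * ‖a‖ ^ 2 ≤ fderiv ℝ (fderiv ℝ V) x a a := by
  have hline : ∀ t : ℝ, HasDerivAt (fun t : ℝ => x + t • a) a t := fun t => by
    simpa using ((hasDerivAt_id t).smul_const a).const_add x
  have hconv : ConvexOn ℝ Set.univ fun t : ℝ => V (x + t • a) + κ / 2 * ‖x + t • a‖ ^ 2 := by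
    have := h.comp_affineMap (AffineMap.lineMap x (x + a))
    simpa [Function.comp_def, AffineMap.lineMap_apply, add_comm] using this
  have hd : ∀ t : ℝ, HasDerivAt (fun t : ℝ => V (x + t • a) + κ / 2 * ‖x + t • a‖ ^ 2)
      (fderiv ℝ V (x + t • a) a + κ / 2 * (2 * inner ℝ (x + t • a) a)) t := fun t => by
    have h1 := ((hV.differentiable two_ne_zero (x + t • a)).hasFDerivAt).comp_hasDerivAt t (hline t)
    exact h1.add (((hline t).norm_sq).const_mul _)
  have hmono := hconv.monotoneOn_deriv fun t _ => (hd t).differentiableAt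
  rw [monotoneOn_univ] at hmono
  have hd2 : HasDerivAt (deriv fun t : ℝ => V (x + t • a) + κ / 2 * ‖x + t • a‖ ^ 2)
      (fderiv ℝ (fderiv ℝ V) x a a + κ / 2 * (2 * ‖a‖ ^ 2)) 0 := by
    rw [funext fun t => (hd t).deriv]
    have h2 : DifferentiableAt ℝ (fderiv ℝ V) (x + (0 : ℝ) • a) :=
      (hV.fderiv_right (m := 1) (by norm_num)).differentiable one_ne_zero _
    have h3 : HasDerivAt (fun t : ℝ => fderiv ℝ V (x + t • a) a)
        (fderiv ℝ (fderiv ℝ V) x a a) 0 := by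
      have h6 : HasDerivAt (fun t : ℝ => fderiv ℝ V (x + t • a))
          (fderiv ℝ (fderiv ℝ V) (x + (0 : ℝ) • a) a) 0 :=
        h2.hasFDerivAt.comp_hasDerivAt 0 (hline 0)
      simpa using h6.clm_apply (hasDerivAt_const 0 a)
    have h4 : HasDerivAt (fun t : ℝ => inner ℝ (x + t • a) a) (‖a‖ ^ 2) 0 := by
      simpa using (hline 0).inner ℝ (hasDerivAt_const 0 a)
    exact h3.add ((h4.const_mul 2).const_mul (κ / 2))
  have := hd2.deriv ▸ hmono.deriv_nonneg (x := 0)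
  linarith

theorem IsSemiConvex.le_sum_pderiv {V : EuclideanSpace ℝ (Fin n) → ℝ} {κ : ℝ}
    (h : IsSemiConvex V κ) (hV : ContDiff ℝ 2 V) (x : EuclideanSpace ℝ (Fin n)) (a : Fin n → ℝ) :
    -κ * ∑ i, a i ^ 2 ≤ ∑ i, ∑ j, pderiv i (pderiv j V) x * a i * a j := by
  have h1 := h.le_fderiv_fderiv hV x (WithLp.toLp 2 a)
  have h2 : WithLp.toLp 2 a = ∑ i, a i • EuclideanSpace.single i (1 : ℝ) := by
    ext j
    simp [Pi.single_apply]
  rw [EuclideanSpace.norm_sq_eq] at h1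
  simp only [Real.norm_eq_abs, sq_abs] at h1
  refine h1.trans_eq ?_
  rw [h2]
  simp only [map_sum, map_smul, sum_apply, smul_apply,
    smul_eq_mul, Finset.mul_sum, pderiv_pderiv hV]
  refine (Finset.sum_comm.trans ?_)
  refine Finset.sum_congr rfl fun i _ => Finset.sum_congr rfl fun j _ => ?_
  ring

end PartialDerivative

/-! ### The Hessian inequality for compactly supported test functions. -/

section CoreInequality

variable {n : ℕ} {V : EuclideanSpace ℝ (Fin n) → ℝ}

theorem weightedLaplacian_funext {g : EuclideanSpace ℝ (Fin n) → ℝ} (hg : ContDiff ℝ 2 g) :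
    weightedLaplacian V g =
      fun x => ∑ i, (pderiv i (pderiv i g) x - pderiv i g x * pderiv i V x) :=
  funext fun _ => weightedLaplacian_eq hg

theorem measurable_gibbsDensity (hV : Continuous V) :
    Measurable fun x => ENNReal.ofReal (Real.exp (-V x)) :=
  (ENNReal.continuous_ofReal.comp (Real.continuous_exp.comp hV.neg)).measurable

theorem integral_gibbsMeasure (hV : Continuous V) (g : EuclideanSpace ℝ (Fin n) → ℝ) :
    ∫ x, g x ∂(gibbsMeasure V) = ∫ x, Real.exp (-V x) * g x := by
  rw [gibbsMeasure, integral_withDensity_eq_integral_toReal_smul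
    (measurable_gibbsDensity hV) (by simp)]
  simp [ENNReal.toReal_ofReal (Real.exp_pos _).le]

theorem integrable_gibbsMeasure_iff (hV : Continuous V) {g : EuclideanSpace ℝ (Fin n) → ℝ} :
    Integrable g (gibbsMeasure V) ↔ Integrable fun x => Real.exp (-V x) * g x := by
  rw [gibbsMeasure, integrable_withDensity_iff_integrable_smul'
    (measurable_gibbsDensity hV) (by simp)]
  simp [ENNReal.toReal_ofReal (Real.exp_pos _).le]

theorem integrable_gibbsMeasure (hV : Continuous V) {g : EuclideanSpace ℝ (Fin n) → ℝ}
    (hg : Continuous g) (hc : HasCompactSupport g) : Integrable g (gibbsMeasure V) :=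
  have := isLocallyFiniteMeasure_gibbsMeasure hV
  hg.integrable_of_hasCompactSupport hc

theorem integral_pderiv_mul_gibbsMeasure (hV : ContDiff ℝ 1 V)
    {g k : EuclideanSpace ℝ (Fin n) → ℝ} (hg : ContDiff ℝ 1 g) (hk : ContDiff ℝ 1 k)
    (hc : HasCompactSupport g) (i : Fin n) :
    ∫ x, pderiv i g x * k x ∂(gibbsMeasure V) =
      ∫ x, g x * (k x * pderiv i V x - pderiv i k x) ∂(gibbsMeasure V) := by
  rw [integral_gibbsMeasure hV.continuous, integral_gibbsMeasure hV.continuous]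
  have h := integral_pderiv_mul (i := i) hg (hk.mul hV.neg.exp) hc
  calc _ = ∫ x, pderiv i g x * (k x * Real.exp (-V x)) := by congr 1 with x; ring
    _ = _ := by
      rw [h, ← integral_neg]
      congr 1 with x
      have hVx : DifferentiableAt ℝ (fun y => -V y) x := (hV.differentiable one_ne_zero x).neg
      rw [pderiv_mul (hk.differentiable one_ne_zero x) hVx.exp, pderiv_exp hVx, pderiv_neg]
      ring

theorem continuous_weightedLaplacian (hV : ContDiff ℝ 2 V) {g : EuclideanSpace ℝ (Fin n) → ℝ}
    (hg : ContDiff ℝ 2 g) : Continuous (weightedLaplacian V g) := by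
  rw [weightedLaplacian_funext hg]
  refine continuous_finsetSum _ fun i _ => ?_
  have h1 := hg.pderiv (l := 1) (by norm_num) i
  exact (h1.pderiv (l := 0) (by norm_num) i).continuous.sub
    (h1.continuous.mul (hV.pderiv (l := 1) (by norm_num) i).continuous)

theorem hasCompactSupport_weightedLaplacian {g : EuclideanSpace ℝ (Fin n) → ℝ}
    (hc : HasCompactSupport g) (hg : ContDiff ℝ 2 g) :
    HasCompactSupport (weightedLaplacian V g) := by
  refine hc.mono' fun x hx => ?_
  by_contra h
  have hz : ∀ i, pderiv i g x = 0 := fun i =>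
    image_eq_zero_of_notMem_tsupport fun h' => h (tsupport_fderiv_apply_subset ℝ _ h')
  have hz2 : ∀ i, pderiv i (pderiv i g) x = 0 := fun i =>
    image_eq_zero_of_notMem_tsupport fun h' => h (tsupport_fderiv_apply_subset ℝ _
      (tsupport_fderiv_apply_subset ℝ _ h'))
  exact hx (by simp [weightedLaplacian_funext hg, hz, hz2])

/-- Green's formula for `μ`: the drift term of `L` cancels the derivative of the density `e^{-V}`.
Only `g` has compact support, so `k` may be shifted by a constant, which
`SatisfiesPoincare.energy_le` exploits. -/
theorem integral_mul_weightedLaplacian (hV : ContDiff ℝ 2 V)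
    {g k : EuclideanSpace ℝ (Fin n) → ℝ} (hg : ContDiff ℝ 2 g) (hk : ContDiff ℝ 1 k)
    (hc : HasCompactSupport g) :
    ∫ x, k x * weightedLaplacian V g x ∂(gibbsMeasure V) =
      -∑ i, ∫ x, pderiv i g x * pderiv i k x ∂(gibbsMeasure V) := by
  have hV1 : ContDiff ℝ 1 V := hV.of_le (by norm_num)
  have hg1 := fun i => hg.pderiv (l := 1) (by norm_num) i
  have hg2 := fun i => ((hg1 i).pderiv (l := 0) (by norm_num) i).continuous
  have hV' := fun i => (hV.pderiv (l := 1) (by norm_num) i).continuous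
  have hk' := fun i => (hk.pderiv (l := 0) (by norm_num) i).continuous
  have hcont := hV.continuous
  calc _ = ∑ i, ∫ x, (pderiv i (pderiv i g) x * k x
        - pderiv i g x * (k x * pderiv i V x)) ∂(gibbsMeasure V) := by
        rw [← integral_finsetSum]
        · congr 1 with x
          rw [weightedLaplacian_eq hg, Finset.mul_sum]
          exact Finset.sum_congr rfl fun i _ => by ring
        · intro i _
          refine integrable_gibbsMeasure hcont ?_ ?_
          · exact ((hg2 i).mul hk.continuous).sub
              ((hg1 i).continuous.mul (hk.continuous.mul (hV' i)))
          · exact (((hc.pderiv i).pderiv i).mul_right (f' := k)).sub ((hc.pderiv i).mul_right)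
    _ = _ := by
        rw [← Finset.sum_neg_distrib]
        refine Finset.sum_congr rfl fun i _ => ?_
        have i1 : Integrable (fun x => pderiv i (pderiv i g) x * k x) (gibbsMeasure V) :=
          integrable_gibbsMeasure hcont ((hg2 i).mul hk.continuous) ((hc.pderiv i).pderiv i).mul_right
        have i2 : Integrable (fun x => pderiv i g x * (k x * pderiv i V x)) (gibbsMeasure V) :=
          integrable_gibbsMeasure hcont ((hg1 i).continuous.mul (hk.continuous.mul (hV' i)))
            (hc.pderiv i).mul_right
        have i3 : Integrable (fun x => pderiv i g x * (k x * pderiv i V x - pderiv i k x))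
            (gibbsMeasure V) :=
          integrable_gibbsMeasure hcont
            ((hg1 i).continuous.mul ((hk.continuous.mul (hV' i)).sub (hk' i)))
            (hc.pderiv i).mul_right
        rw [integral_sub i1 i2, integral_pderiv_mul_gibbsMeasure hV1 (hg1 i) hk (hc.pderiv i) i,
          ← integral_sub i3 i2, ← integral_neg]
        congr 1 with x
        ring

/-- The commutator of `∂ᵢ` and `L` is the source of the Hessian of `V` in the Bochner formula. -/
theorem pderiv_weightedLaplacian (hV : ContDiff ℝ 2 V) {g : EuclideanSpace ℝ (Fin n) → ℝ}
    (hg : ContDiff ℝ 3 g) (i : Fin n) (x : EuclideanSpace ℝ (Fin n)) :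
    pderiv i (weightedLaplacian V g) x =
      weightedLaplacian V (pderiv i g) x - ∑ j, pderiv i (pderiv j V) x * pderiv j g x := by
  have hg2 : ContDiff ℝ 2 g := hg.of_le (by norm_num)
  have h2 := fun j => hg.pderiv (l := 2) (by norm_num) j
  have h1 := fun j k => (h2 j).pderiv (l := 1) (by norm_num) k
  have hV1 := fun j => hV.pderiv (l := 1) (by norm_num) j
  have d0 := fun j => (h2 j).differentiable two_ne_zero x
  have d1 := fun j k => (h1 j k).differentiable one_ne_zero x
  have dV := fun j => (hV1 j).differentiable one_ne_zero x
  rw [weightedLaplacian_funext hg2, weightedLaplacian_eq (h2 i),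
    pderiv_sum (G := fun j y => pderiv j (pderiv j g) y - pderiv j g y * pderiv j V y)
      fun j _ => (d1 j j).sub ((d0 j).mul (dV j)), ← Finset.sum_sub_distrib]
  refine Finset.sum_congr rfl fun j _ => ?_
  rw [pderiv_sub (k := fun y => pderiv j g y * pderiv j V y) (d1 j j) ((d0 j).mul (dV j)),
    pderiv_mul (d0 j) (dV j), pderiv_comm (h2 j),
    show pderiv i (pderiv j g) = pderiv j (pderiv i g) from funext fun _ => pderiv_comm hg2]
  ring

theorem contDiff_weightedLaplacian (hV : ContDiff ℝ 2 V) {g : EuclideanSpace ℝ (Fin n) → ℝ}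
    (hg : ContDiff ℝ 3 g) : ContDiff ℝ 1 (weightedLaplacian V g) := by
  rw [weightedLaplacian_funext (hg.of_le (by norm_num))]
  refine ContDiff.sum fun i _ => ?_
  have h1 := hg.pderiv (l := 2) (by norm_num) i
  exact (h1.pderiv (l := 1) (by norm_num) i).sub
    ((h1.of_le (by norm_num)).mul (hV.pderiv (l := 1) (by norm_num) i))

/-- The integrated Bochner formula. -/
theorem integral_weightedLaplacian_sq (hV : ContDiff ℝ 2 V) {g : EuclideanSpace ℝ (Fin n) → ℝ}
    (hg : ContDiff ℝ 3 g) (hc : HasCompactSupport g) :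
    ∫ x, weightedLaplacian V g x ^ 2 ∂(gibbsMeasure V) =
      ∑ i, ∑ j, ∫ x, pderiv i (pderiv j g) x ^ 2 ∂(gibbsMeasure V) +
      ∫ x, ∑ i, ∑ j, pderiv i (pderiv j V) x * pderiv i g x * pderiv j g x ∂(gibbsMeasure V) := by
  have hg2 : ContDiff ℝ 2 g := hg.of_le (by norm_num)
  have h2 := fun j => hg.pderiv (l := 2) (by norm_num) j
  have hVc := fun i j =>
    ((hV.pderiv (l := 1) (by norm_num) j).pderiv (l := 0) (by norm_num) i).continuous
  have hL := contDiff_weightedLaplacian hV hg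
  have hterm : ∀ i, ∫ x, pderiv i g x * pderiv i (weightedLaplacian V g) x ∂(gibbsMeasure V) =
      -(∑ j, ∫ x, pderiv i (pderiv j g) x ^ 2 ∂(gibbsMeasure V)) -
      ∫ x, ∑ j, pderiv i (pderiv j V) x * pderiv i g x * pderiv j g x ∂(gibbsMeasure V) := by
    intro i
    have hs := integral_mul_weightedLaplacian hV (h2 i) ((h2 i).of_le (by norm_num)) (hc.pderiv i)
    have h3 : ∀ j, ∫ x, pderiv i (pderiv j g) x ^ 2 ∂(gibbsMeasure V) =
        ∫ x, pderiv j (pderiv i g) x * pderiv j (pderiv i g) x ∂(gibbsMeasure V) := fun j => by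
      simp only [pderiv_comm (i := i) (j := j) hg2, sq]
    simp only [h3]
    rw [← hs, ← integral_sub]
    · congr 1 with x
      rw [pderiv_weightedLaplacian hV hg, mul_sub, Finset.mul_sum]
      congr 1
      exact Finset.sum_congr rfl fun j _ => by ring
    · exact integrable_gibbsMeasure hV.continuous
        ((h2 i).continuous.mul (continuous_weightedLaplacian hV (h2 i))) (hc.pderiv i).mul_right
    · refine integrable_finsetSum _ fun j _ => integrable_gibbsMeasure hV.continuous
        (((hVc i j).mul (h2 i).continuous).mul (h2 j).continuous) (hc.pderiv j).mul_left
  simp only [sq (weightedLaplacian V g _)]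
  -- One factor `L g` serves as the test function `k`. It has to be `C¹`, which is what `g ∈ C³` and
  -- `V ∈ C²` provide.
  rw [integral_mul_weightedLaplacian hV hg2 hL hc]
  simp only [hterm]
  rw [integral_finsetSum]
  · simp only [Finset.sum_sub_distrib, Finset.sum_neg_distrib]
    ring
  · refine fun i _ => integrable_finsetSum _ fun j _ => integrable_gibbsMeasure hV.continuous
        (((hVc i j).mul (h2 i).continuous).mul (h2 j).continuous) (hc.pderiv j).mul_left

theorem sum_integral_hessian_sq_le (hV : ContDiff ℝ 2 V) {κ : ℝ} (hsc : IsSemiConvex V κ)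
    {g : EuclideanSpace ℝ (Fin n) → ℝ} (hg : ContDiff ℝ 3 g) (hc : HasCompactSupport g) :
    ∑ i, ∑ j, ∫ x, pderiv i (pderiv j g) x ^ 2 ∂(gibbsMeasure V) ≤
      ∫ x, weightedLaplacian V g x ^ 2 ∂(gibbsMeasure V) +
        κ * ∑ i, ∫ x, pderiv i g x ^ 2 ∂(gibbsMeasure V) := by
  have h2 := fun j => hg.pderiv (l := 2) (by norm_num) j
  have hVc := fun i j =>
    ((hV.pderiv (l := 1) (by norm_num) j).pderiv (l := 0) (by norm_num) i).continuous
  have hi : ∀ i, Integrable (fun x => pderiv i g x ^ 2) (gibbsMeasure V) := fun i =>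
    integrable_gibbsMeasure hV.continuous ((h2 i).continuous.pow 2)
      ((hc.pderiv i).comp_left (g := (· ^ 2)) (by simp))
  have hmono : ∫ x, -κ * ∑ i, pderiv i g x ^ 2 ∂(gibbsMeasure V) ≤
      ∫ x, ∑ i, ∑ j, pderiv i (pderiv j V) x * pderiv i g x * pderiv j g x ∂(gibbsMeasure V) := by
    refine integral_mono ((integrable_finsetSum _ fun i _ => hi i).const_mul _) ?_
      fun x => hsc.le_sum_pderiv hV x fun i => pderiv i g x
    exact integrable_finsetSum _ fun i _ => integrable_finsetSum _ fun j _ =>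
      integrable_gibbsMeasure hV.continuous
        (((hVc i j).mul (h2 i).continuous).mul (h2 j).continuous) (hc.pderiv j).mul_left
  rw [integral_const_mul, integral_finsetSum _ fun i _ => hi i] at hmono
  rw [integral_weightedLaplacian_sq hV hg hc]
  linarith

/-- The constant is `max C 0` because no sign is assumed on `C` and `ENNReal.ofReal` truncates at
zero. -/
theorem SatisfiesPoincare.variance_le (hV : ContDiff ℝ 1 V) [IsProbabilityMeasure (gibbsMeasure V)]
    {C : ℝ} (hP : SatisfiesPoincare (gibbsMeasure V) C) {g : EuclideanSpace ℝ (Fin n) → ℝ}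
    (hg : ContDiff ℝ 1 g) (hc : HasCompactSupport g) :
    variance g (gibbsMeasure V) ≤ max C 0 * ∑ i, ∫ x, pderiv i g x ^ 2 ∂(gibbsMeasure V) := by
  have hi : ∀ i, Integrable (fun x => pderiv i g x ^ 2) (gibbsMeasure V) := fun i =>
    integrable_gibbsMeasure hV.continuous ((hg.pderiv (l := 0) (by simp) i).continuous.pow 2)
      ((hc.pderiv i).comp_left (g := (· ^ 2)) (by simp))
  have h := hP g hg.locallyLipschitz
  have hE : ∫⁻ x, ‖∇ g x‖ₑ ^ 2 ∂(gibbsMeasure V) =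
      ENNReal.ofReal (∑ i, ∫ x, pderiv i g x ^ 2 ∂(gibbsMeasure V)) := by
    rw [← integral_finsetSum _ fun i _ => hi i, ofReal_integral_eq_lintegral_ofReal
      (integrable_finsetSum _ fun i _ => hi i)
      (Filter.Eventually.of_forall fun x => Finset.sum_nonneg fun i _ => sq_nonneg _)]
    refine lintegral_congr fun x => ?_
    rw [← norm_gradient_sq, ← ofReal_norm, ENNReal.ofReal_pow (norm_nonneg _)]
  rw [← ofReal_variance (memLp_gibbsMeasure hV.continuous hg.continuous hc), hE,
    show ENNReal.ofReal C = ENNReal.ofReal (max C 0) by simp, ← ENNReal.ofReal_mul (le_max_right _ _)] at h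
  exact (ENNReal.ofReal_le_ofReal_iff (mul_nonneg (le_max_right _ _)
    (Finset.sum_nonneg fun i _ => integral_nonneg fun x => sq_nonneg _))).1 h

/-- Young's inequality with weight `C` bounds `∫ |∇g|² = -∫ (g - m) L g` by `(2C)⁻¹ var g + (C/2) ∫
(L g)²`. By Poincaré the first term is at most half the energy and is absorbed on the left. -/
theorem SatisfiesPoincare.energy_le (hV : ContDiff ℝ 2 V) [IsProbabilityMeasure (gibbsMeasure V)]
    {C : ℝ} (hC : 0 < C) (hP : SatisfiesPoincare (gibbsMeasure V) C)
    {g : EuclideanSpace ℝ (Fin n) → ℝ} (hg : ContDiff ℝ 2 g) (hc : HasCompactSupport g) :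
    ∑ i, ∫ x, pderiv i g x ^ 2 ∂(gibbsMeasure V) ≤
      C * ∫ x, weightedLaplacian V g x ^ 2 ∂(gibbsMeasure V) := by
  have hvar := hP.variance_le (hV.of_le (by norm_num)) (hg.of_le (by norm_num)) hc
  rw [max_eq_left hC.le, variance_eq_integral hg.continuous.aemeasurable] at hvar
  set m := ∫ x, g x ∂(gibbsMeasure V)
  have hk : ContDiff ℝ 1 fun x => g x - m := (hg.sub contDiff_const).of_le (by norm_num)
  have hs := integral_mul_weightedLaplacian hV hg hk hc
  have hp : ∀ i x, pderiv i (fun x => g x - m) x = pderiv i g x := fun i x => by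
    simp [pderiv, fderiv_sub_const]
  simp only [hp, ← sq] at hs
  have hgm : MemLp (fun x => g x - m) 2 (gibbsMeasure V) :=
    (memLp_gibbsMeasure hV.continuous hg.continuous hc).sub (memLp_const m)
  have hL : MemLp (weightedLaplacian V g) 2 (gibbsMeasure V) := 
    memLp_gibbsMeasure hV.continuous (continuous_weightedLaplacian hV hg)
      (hasCompactSupport_weightedLaplacian hc hg)
  have hle : -∫ x, (g x - m) * weightedLaplacian V g x ∂(gibbsMeasure V) ≤
      ∫ x, ((2 * C)⁻¹ * (g x - m) ^ 2 + C / 2 * weightedLaplacian V g x ^ 2)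
        ∂(gibbsMeasure V) := by
    rw [← integral_neg]
    refine integral_mono (hgm.integrable_mul hL).neg
      ((hgm.integrable_sq.const_mul _).add (hL.integrable_sq.const_mul _)) fun x => ?_
    have h1 : (2 * C)⁻¹ * (g x - m) ^ 2 + C / 2 * weightedLaplacian V g x ^ 2
        - -((g x - m) * weightedLaplacian V g x)
        = (2 * C)⁻¹ * ((g x - m) + C * weightedLaplacian V g x) ^ 2 := by
      field_simp
      ring
    have h2 : 0 ≤ (2 * C)⁻¹ * ((g x - m) + C * weightedLaplacian V g x) ^ 2 := by positivity
    linarith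
  rw [integral_add (hgm.integrable_sq.const_mul _) (hL.integrable_sq.const_mul _),
    integral_const_mul, integral_const_mul] at hle
  have h3 := mul_le_mul_of_nonneg_left hvar (by positivity : 0 ≤ (2 * C)⁻¹)
  have h4 : (2 * C)⁻¹ * (C * ∑ i, ∫ x, pderiv i g x ^ 2 ∂(gibbsMeasure V)) =
      1 / 2 * ∑ i, ∫ x, pderiv i g x ^ 2 ∂(gibbsMeasure V) := by
    field_simp
  linarith

theorem SatisfiesPoincare.sum_integral_hessian_sq_le (hV : ContDiff ℝ 2 V)
    [IsProbabilityMeasure (gibbsMeasure V)] {C κ : ℝ} (hκ : 0 ≤ κ)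
    (hP : SatisfiesPoincare (gibbsMeasure V) C) (hsc : IsSemiConvex V κ)
    {g : EuclideanSpace ℝ (Fin n) → ℝ} (hg : ContDiff ℝ 3 g) (hc : HasCompactSupport g) :
    ∑ i, ∑ j, ∫ x, pderiv i (pderiv j g) x ^ 2 ∂(gibbsMeasure V) ≤
      (1 + κ * C) * ∫ x, weightedLaplacian V g x ^ 2 ∂(gibbsMeasure V) := by
  have hg2 : ContDiff ℝ 2 g := hg.of_le (by norm_num)
  rcases lt_or_ge 0 C with hC | hC
  · have h1 := _root_.sum_integral_hessian_sq_le hV hsc hg hc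
    have h2 := mul_le_mul_of_nonneg_left (hP.energy_le hV hC hg2 hc) hκ
    linarith
  -- For `C ≤ 0` the variance vanishes, so the continuous function `g` is constant and both sides
  -- are zero.
  · have hvar := hP.variance_le (hV.of_le (by norm_num)) (hg.of_le (by norm_num)) hc
    rw [max_eq_right hC, zero_mul] at hvar
    have hae := ae_eq_integral_of_variance_eq_zero
      (memLp_gibbsMeasure hV.continuous hg.continuous hc) (hvar.antisymm (variance_nonneg _ _))
    have hconst : g = fun _ => ∫ x, g x ∂(gibbsMeasure V) :=
      Measure.eq_of_ae_eq ((volume_absolutelyContinuous_gibbsMeasure hV.continuous).ae_le hae)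
        hg.continuous continuous_const
    have h1 : ∀ i, pderiv i g = 0 := fun i => by
      rw [hconst]
      ext x
      simp [pderiv]
    have h2 : ∀ i, pderiv i (0 : EuclideanSpace ℝ (Fin n) → ℝ) = 0 := fun i => by
      ext x
      simp [pderiv]
    simp [weightedLaplacian_funext hg2, h1, h2]

end CoreInequality

/-! ### Local `L²` convergence of mollifications. -/

section Mollification

open Filter Topology Metric ContinuousLinearMap
open scoped Convolution ENNReal

variable {n : ℕ} {g : EuclideanSpace ℝ (Fin n) → ℝ}

theorem tendsto_lintegral_translate_sub_sq (hg : MemLp g 2 volume) :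
    Tendsto (fun t => ∫⁻ x, ‖g (x - t) - g x‖ₑ ^ 2) (𝓝 0) (𝓝 0) := by
  let T : EuclideanSpace ℝ (Fin n) → C(EuclideanSpace ℝ (Fin n), EuclideanSpace ℝ (Fin n)) :=
    fun t => ⟨fun x => x - t, continuous_id.sub continuous_const⟩
  have hT : Continuous T :=
    ContinuousMap.continuous_of_continuous_uncurry _ (continuous_snd.sub continuous_fst)
  have hmp : ∀ t, MeasurePreserving (T t) volume volume := fun t => measurePreserving_sub_right _ t
  have h := (continuous_const (y := hg.toLp g)).compMeasurePreservingLp hT hmp (by norm_num)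
  have h0 := (h.tendsto 0).edist (tendsto_const_nhds (x := hg.toLp g))
  have hz : Lp.compMeasurePreserving (T 0) (hmp 0) (hg.toLp g) = hg.toLp g := by
    rw [Lp.toLp_compMeasurePreserving]
    exact MemLp.toLp_congr _ _ (Eventually.of_forall fun x => by simp [T])
  rw [hz, edist_self] at h0
  have h1 := ((ENNReal.continuous_pow 2).tendsto 0).comp h0
  simp only [Function.comp_def, Lp.toLp_compMeasurePreserving, Lp.edist_toLp_toLp] at h1
  refine (h1.congr fun t => ?_).trans (by simp)
  have := eLpNorm_nnreal_pow_eq_lintegral (μ := volume) (p := 2) (f := g ∘ T t - g) (by norm_num)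
  simpa [T, Function.comp_def] using this

/-- Jensen's inequality for the probability measure `ρ(t) dt`, in the form `L¹ norm ≤ L² norm`. -/
theorem enorm_normed_convolution_sub_sq_le (hg : Measurable g) (hli : LocallyIntegrable g volume)
    (φ : ContDiffBump (0 : EuclideanSpace ℝ (Fin n))) (x : EuclideanSpace ℝ (Fin n)) :
    ‖(φ.normed volume ⋆[lsmul ℝ ℝ, volume] g) x - g x‖ₑ ^ 2 ≤
      ∫⁻ t, ENNReal.ofReal (φ.normed volume t) * ‖g (x - t) - g x‖ₑ ^ 2 := by
  set ρ := φ.normed volume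
  have hρm : Measurable fun t => ENNReal.ofReal (ρ t) :=
    φ.continuous_normed.measurable.ennreal_ofReal
  have hex : Integrable (fun t => ρ t * g (x - t)) volume :=
    φ.hasCompactSupport_normed.convolutionExists_left (lsmul ℝ ℝ) φ.continuous_normed hli x
  have heq : (ρ ⋆[lsmul ℝ ℝ, volume] g) x - g x = ∫ t, ρ t * (g (x - t) - g x) := by
    have h1 : ∫ t, ρ t * g x = g x := by
      rw [integral_mul_const, φ.integral_normed, one_mul]
    rw [convolution_lsmul]
    conv_lhs => rw [← h1]
    simp only [smul_eq_mul, mul_sub]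
    exact (integral_sub hex (φ.integrable_normed.mul_const _)).symm
  let ν := volume.withDensity fun t => ENNReal.ofReal (ρ t)
  have hν : IsProbabilityMeasure ν := ⟨by
    rw [withDensity_apply _ MeasurableSet.univ, Measure.restrict_univ,
      ← ofReal_integral_eq_lintegral_ofReal φ.integrable_normed
        (Eventually.of_forall φ.nonneg_normed), φ.integral_normed, ENNReal.ofReal_one]⟩
  have hm : Measurable fun t => g (x - t) - g x :=
    (hg.comp (measurable_const.sub measurable_id)).sub measurable_const
  have h1 : ‖(ρ ⋆[lsmul ℝ ℝ, volume] g) x - g x‖ₑ ≤ eLpNorm (fun t => g (x - t) - g x) 1 ν := by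
    rw [heq, eLpNorm_one_eq_lintegral_enorm, lintegral_withDensity_eq_lintegral_mul _ hρm hm.enorm]
    refine (enorm_integral_le_lintegral_enorm _).trans_eq (lintegral_congr fun t => ?_)
    rw [enorm_mul, Real.enorm_of_nonneg (φ.nonneg_normed t), Pi.mul_apply]
  have h2 : eLpNorm (fun t => g (x - t) - g x) 1 ν ≤ eLpNorm (fun t => g (x - t) - g x) 2 ν :=
    eLpNorm_le_eLpNorm_of_exponent_le (by norm_num) hm.aestronglyMeasurable
  have h3 := eLpNorm_nnreal_pow_eq_lintegral (μ := ν) (p := 2) (f := fun t => g (x - t) - g x)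
    (by norm_num)
  have h4 : eLpNorm (fun t => g (x - t) - g x) 2 ν ^ 2 =
      ∫⁻ t, ENNReal.ofReal (ρ t) * ‖g (x - t) - g x‖ₑ ^ 2 := by
    rw [show (∫⁻ t, ENNReal.ofReal (ρ t) * ‖g (x - t) - g x‖ₑ ^ 2) =
      ∫⁻ t, ‖g (x - t) - g x‖ₑ ^ 2 ∂ν from
      (lintegral_withDensity_eq_lintegral_mul _ hρm (hm.enorm.pow_const 2)).symm]
    simpa using h3
  rw [← h4]
  exact pow_le_pow_left' (h1.trans h2) 2

/-- By Tonelli, the error is at most an average over `t` of translation errors; the kernel vanishes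
off the ball of radius `rOut`, so only small `t` count. -/
theorem setLIntegral_normed_convolution_sub_sq_le (hg : Measurable g)
    (hli : LocallyIntegrable g volume) (φ : ContDiffBump (0 : EuclideanSpace ℝ (Fin n)))
    (B : Set (EuclideanSpace ℝ (Fin n))) {c : ℝ≥0∞}
    (hc : ∀ t ∈ ball 0 φ.rOut, ∫⁻ x in B, ‖g (x - t) - g x‖ₑ ^ 2 ≤ c) :
    ∫⁻ x in B, ‖(φ.normed volume ⋆[lsmul ℝ ℝ, volume] g) x - g x‖ₑ ^ 2 ≤ c := by
  set ρ := φ.normed volume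
  have hρm : Measurable fun t => ENNReal.ofReal (ρ t) :=
    φ.continuous_normed.measurable.ennreal_ofReal
  have hm : Measurable fun p : EuclideanSpace ℝ (Fin n) × EuclideanSpace ℝ (Fin n) =>
      ‖g (p.1 - p.2) - g p.1‖ₑ ^ 2 :=
    (((hg.comp (measurable_fst.sub measurable_snd)).sub (hg.comp measurable_fst)).enorm).pow_const 2
  calc _ ≤ ∫⁻ x in B, ∫⁻ t, ENNReal.ofReal (ρ t) * ‖g (x - t) - g x‖ₑ ^ 2 :=
        lintegral_mono fun x => enorm_normed_convolution_sub_sq_le hg hli φ x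
    _ = ∫⁻ t, ∫⁻ x in B, ENNReal.ofReal (ρ t) * ‖g (x - t) - g x‖ₑ ^ 2 :=
        lintegral_lintegral_swap (((hρm.comp measurable_snd).mul hm).aemeasurable)
    _ ≤ ∫⁻ t, ENNReal.ofReal (ρ t) * c := by
        refine lintegral_mono fun t => ?_
        rw [lintegral_const_mul' _ _ ENNReal.ofReal_ne_top]
        by_cases ht : t ∈ ball 0 φ.rOut
        · exact mul_le_mul_right (hc t ht) _
        · rw [← φ.support_normed_eq (μ := volume), Function.notMem_support] at ht
          simp [ρ, ht]
    _ = c := by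
        rw [lintegral_mul_const _ hρm, ← ofReal_integral_eq_lintegral_ofReal φ.integrable_normed
          (Eventually.of_forall φ.nonneg_normed), φ.integral_normed, ENNReal.ofReal_one, one_mul]

/-- Mollifications converge in `L²` on bounded sets. -/
theorem tendsto_setIntegral_normed_convolution_sub_sq (hg : Measurable g)
    (hli : LocallyIntegrable g volume)
    (hL : ∀ R, MemLp g 2 (volume.restrict (closedBall 0 R)))
    {φ : ℕ → ContDiffBump (0 : EuclideanSpace ℝ (Fin n))}
    (hφ : Tendsto (fun k => (φ k).rOut) atTop (𝓝 0)) (R : ℝ) :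
    Tendsto (fun k => ∫ x in closedBall 0 R,
      (((φ k).normed volume ⋆[lsmul ℝ ℝ, volume] g) x - g x) ^ 2) atTop (𝓝 0) := by
  have hlint : Tendsto (fun k => ∫⁻ x in closedBall 0 R,
      ‖((φ k).normed volume ⋆[lsmul ℝ ℝ, volume] g) x - g x‖ₑ ^ 2) atTop (𝓝 0) := by
    -- Translation is continuous in `L²` for globally square integrable functions, so `g` is
    -- truncated. The margin 1 keeps `x - t` inside the larger ball when `‖x‖ ≤ R` and `‖t‖ < 1`.
    have hG : MemLp ((closedBall 0 (R + 1)).indicator g) 2 volume :=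
      (memLp_indicator_iff_restrict measurableSet_closedBall).2 (hL (R + 1))
    have ht := tendsto_lintegral_translate_sub_sq hG
    rw [ENNReal.tendsto_nhds_zero] at ht ⊢
    intro ε hε
    obtain ⟨δ, hδ, hball⟩ := Metric.eventually_nhds_iff_ball.1 (ht ε hε)
    filter_upwards [hφ.eventually_lt_const (lt_min hδ one_pos)] with k hk
    refine setLIntegral_normed_convolution_sub_sq_le hg hli (φ k) _ fun t ht => ?_
    have htn : ‖t‖ < min δ 1 := (mem_ball_zero_iff.1 ht).trans hk
    refine le_trans ?_ (hball t (mem_ball_zero_iff.2 (htn.trans_le (min_le_left _ _))))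
    refine le_trans (setLIntegral_mono_ae' measurableSet_closedBall
      (Eventually.of_forall fun x hx => le_of_eq ?_)) (setLIntegral_le_lintegral _ _)
    have hx' : ‖x‖ ≤ R := mem_closedBall_zero_iff.1 hx
    have ht1 : ‖t‖ < 1 := htn.trans_le (min_le_right _ _)
    rw [Set.indicator_of_mem, Set.indicator_of_mem]
    · exact mem_closedBall_zero_iff.2 (by linarith)
    · exact mem_closedBall_zero_iff.2 (by linarith [norm_sub_le x t])
  have := (ENNReal.tendsto_toReal ENNReal.zero_ne_top).comp hlint
  refine (this.congr fun k => ?_).trans (by simp)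
  have hm : Measurable fun x => ((φ k).normed volume ⋆[lsmul ℝ ℝ, volume] g) x - g x :=
    (((φ k).hasCompactSupport_normed.contDiff_convolution_left (n := 0) (lsmul ℝ ℝ)
      (φ k).contDiff_normed hli).continuous.measurable).sub hg
  rw [integral_eq_lintegral_of_nonneg_ae (Eventually.of_forall fun x => sq_nonneg _)
    (hm.pow_const 2).aestronglyMeasurable]
  simp only [Function.comp_apply]
  congr 1
  refine lintegral_congr fun x => ?_
  rw [← enorm_pow, Real.enorm_of_nonneg (sq_nonneg _)]

end Mollification

/-! ### Mollified weak equation and the Caccioppoli inequality for smooth solutions. -/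

section WeakEquation

open Filter Topology Metric ContinuousLinearMap
open scoped Convolution ENNReal

variable {n : ℕ} {V : EuclideanSpace ℝ (Fin n) → ℝ}

theorem pderiv_convolution {ρ g : EuclideanSpace ℝ (Fin n) → ℝ} (hρ : ContDiff ℝ 1 ρ)
    (hc : HasCompactSupport ρ) (hg : LocallyIntegrable g volume) (i : Fin n) :
    pderiv i (ρ ⋆[lsmul ℝ ℝ, volume] g) = pderiv i ρ ⋆[lsmul ℝ ℝ, volume] g := by
  ext x
  have hex := (hc.fderiv ℝ).convolutionExists_left
    ((lsmul ℝ ℝ : ℝ →L[ℝ] ℝ →L[ℝ] ℝ).precompL (EuclideanSpace ℝ (Fin n)))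
    (hρ.continuous_fderiv one_ne_zero) hg x
  rw [pderiv, (hc.hasFDerivAt_convolution_left (lsmul ℝ ℝ) hρ hg x).fderiv, convolution_def,
    convolution_def, ContinuousLinearMap.integral_apply hex]
  rfl

theorem pderiv_const_sub {ρ : EuclideanSpace ℝ (Fin n) → ℝ} (hρ : Differentiable ℝ ρ)
    (x : EuclideanSpace ℝ (Fin n)) (i : Fin n) :
    pderiv i (fun t => ρ (x - t)) = fun t => -pderiv i ρ (x - t) := by
  ext t
  have h : HasFDerivAt (fun t => ρ (x - t))
      ((fderiv ℝ ρ (x - t)).comp (-ContinuousLinearMap.id ℝ _)) t :=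
    (hρ (x - t)).hasFDerivAt.comp t ((hasFDerivAt_id t).const_sub x)
  rw [pderiv, h.fderiv]
  simp [pderiv]

/-- The mollification of a weak solution `v` of `Δv + div (v ∇V) = v`. -/
theorem sum_pderiv_convolution_eq (hV : ContDiff ℝ 2 V)
    {v ρ : EuclideanSpace ℝ (Fin n) → ℝ} (hv : LocallyIntegrable v volume)
    (hw : ∀ φ ∈ smoothCompact n, ∫ x, v x * (weightedLaplacian V φ x - φ x) = 0)
    (hρ : ContDiff ℝ ∞ ρ) (hc : HasCompactSupport ρ) (x : EuclideanSpace ℝ (Fin n)) :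
    ∑ i, (pderiv i (pderiv i (ρ ⋆[lsmul ℝ ℝ, volume] v)) x +
      pderiv i (ρ ⋆[lsmul ℝ ℝ, volume] fun y => v y * pderiv i V y) x) =
    (ρ ⋆[lsmul ℝ ℝ, volume] v) x := by
  have h1 : ContDiff ℝ 1 ρ := hρ.of_le (WithTop.coe_le_coe.2 le_top)
  have h2 : ContDiff ℝ 2 ρ := hρ.of_le (WithTop.coe_le_coe.2 le_top)
  have hd := fun i => h2.pderiv (l := 1) (by norm_num) i
  have hV' := fun i => (hV.pderiv (l := 1) (by norm_num) i).continuous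
  have hF : ∀ i, LocallyIntegrable (fun y => v y * pderiv i V y) volume := fun i => by
    simpa [mul_comm] using hv.smul_continuous (hV' i)
  have e1 : ∀ i, Integrable (fun t => pderiv i (pderiv i ρ) (x - t) * v t) volume := fun i =>
    ((hc.pderiv i).pderiv i).convolutionExists_left (lsmul ℝ ℝ)
      ((hd i).pderiv (l := 0) (by norm_num) i).continuous hv x |>.integrable_swap
  have e2 : ∀ i, Integrable (fun t => pderiv i ρ (x - t) * (v t * pderiv i V t)) volume := fun i =>
    (hc.pderiv i).convolutionExists_left (lsmul ℝ ℝ) (hd i).continuous (hF i) x |>.integrable_swap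
  have e3 : Integrable (fun t => ρ (x - t) * v t) volume :=
    hc.convolutionExists_left (lsmul ℝ ℝ) h1.continuous hv x |>.integrable_swap
  have hφ : (fun t => ρ (x - t)) ∈ smoothCompact n :=
    ⟨hρ.comp (contDiff_const.sub contDiff_id),
      hc.comp_homeomorph (Homeomorph.subLeft x)⟩
  have hφ2 : ContDiff ℝ 2 fun t => ρ (x - t) := h2.comp (contDiff_const.sub contDiff_id)
  -- The weak equation is tested against the reflected kernel `t ↦ ρ (x - t)`. Reflection flips the
  -- sign of first derivatives and preserves second ones.
  have key := hw _ hφ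
  have hp2 : ∀ i t, pderiv i (pderiv i fun t => ρ (x - t)) t = pderiv i (pderiv i ρ) (x - t) := by
    intro i t
    rw [pderiv_const_sub (h1.differentiable one_ne_zero),
      pderiv_neg, pderiv_const_sub ((hd i).differentiable one_ne_zero), neg_neg]
  simp only [weightedLaplacian_funext hφ2, hp2] at key
  simp only [pderiv_const_sub (h1.differentiable one_ne_zero)] at key
  simp only [pderiv_convolution h1 hc hv, pderiv_convolution h1 hc (hF _),
    pderiv_convolution (hd _) (hc.pderiv _) hv, convolution_lsmul_swap, smul_eq_mul]
  have e12 : ∀ i, Integrable (fun t => pderiv i (pderiv i ρ) (x - t) * v t +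
      pderiv i ρ (x - t) * (v t * pderiv i V t)) volume := fun i => (e1 i).add (e2 i)
  simp only [← fun i => integral_add (e1 i) (e2 i)]
  rw [← integral_finsetSum _ fun i _ => e12 i, ← sub_eq_zero,
    ← integral_sub (integrable_finsetSum _ fun i _ => e12 i) e3, ← key]
  congr 1 with t
  rw [mul_sub, Finset.mul_sum]
  congr 1
  · exact Finset.sum_congr rfl fun i _ => by ring
  · ring

/-- The right side minus the left is `E` times the two squares in the proof. In the application `E =
e^V`, `d = ∂a`, `u = ∂V`, `m = ∂η`, and `w` is the second-order term, untouched by the algebra. The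
combination `d + a u` is `e^{-V} ∂(e^V a)`, and `b - a u` is the error that mollification
introduces. -/
theorem cutoff_energy_le {E : ℝ} (hE : 0 ≤ E) (w η a b d u m : ℝ) :
    w ≤ w + (d + b) * (η * (η * (a * (E * u) + E * d) + a * E * m) + η * (a * E) * m) +
      (2 * (m ^ 2 * E * a ^ 2) + 1 / 2 * (η ^ 2 * E * (b - a * u) ^ 2)) := by
  have h : 0 ≤ E * ((η * (d + a * u) + m * a + η * (b - a * u) / 2) ^ 2 +
      (m * a + η * (b - a * u) / 2) ^ 2) := by positivity
  linarith

/-- Pointwise form of testing the equation with `η² e^V a`: the total derivative integrates to zero,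
leaving the cutoff and commutator errors. -/
theorem cutoff_energy_le_pderiv (hV : ContDiff ℝ 1 V) {a b η : EuclideanSpace ℝ (Fin n) → ℝ}
    (ha : ContDiff ℝ 2 a) (hb : ContDiff ℝ 1 b) (hη : ContDiff ℝ 1 η) (i : Fin n)
    (x : EuclideanSpace ℝ (Fin n)) :
    η x ^ 2 * Real.exp (V x) * a x * (pderiv i (pderiv i a) x + pderiv i b x) ≤
      pderiv i (fun y => η y * (η y * (a y * Real.exp (V y))) * (pderiv i a y + b y)) x +
      (2 * (pderiv i η x ^ 2 * Real.exp (V x) * a x ^ 2) +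
        1 / 2 * (η x ^ 2 * Real.exp (V x) * (b x - a x * pderiv i V x) ^ 2)) := by
  have dη := hη.differentiable one_ne_zero x
  have da := ha.differentiable two_ne_zero x
  have dV := hV.differentiable one_ne_zero x
  have dda := (ha.pderiv (l := 1) (by norm_num) i).differentiable one_ne_zero x
  have db := hb.differentiable one_ne_zero x
  have d1 : DifferentiableAt ℝ (fun y => a y * Real.exp (V y)) x := da.mul dV.exp
  have d2 : DifferentiableAt ℝ (fun y => η y * (a y * Real.exp (V y))) x := dη.mul d1
  have d3 : DifferentiableAt ℝ (fun y => η y * (η y * (a y * Real.exp (V y)))) x := dη.mul d2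
  have d4 : DifferentiableAt ℝ (fun y => pderiv i a y + b y) x := dda.add db
  rw [pderiv_mul d3 d4, pderiv_mul dη d2, pderiv_mul dη d1, pderiv_mul da dV.exp, pderiv_exp dV,
    pderiv_add dda db]
  refine le_trans (le_of_eq ?_) (cutoff_energy_le (Real.exp_pos (V x)).le _ _ _ _ _ _ _)
  ring

theorem integrable_sq_mul_mul_sq {u p q : EuclideanSpace ℝ (Fin n) → ℝ} (hu : Continuous u)
    (hc : HasCompactSupport u) (hp : Continuous p) (hq : Continuous q) :
    Integrable (fun x => u x ^ 2 * p x * q x ^ 2) volume := by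
  have h : HasCompactSupport (u * (u * p * (fun x => q x ^ 2))) := hc.mul_right
  refine (((hu.pow 2).mul hp).mul (hq.pow 2)).integrable_of_hasCompactSupport ?_
  convert! h using 1
  ext x
  simp only [Pi.mul_apply, Pi.pow_apply]
  ring

/-- A Caccioppoli inequality for smooth solutions of `Δa + div b = a`. -/
theorem integral_cutoff_sq_le (hV : ContDiff ℝ 2 V) {a η : EuclideanSpace ℝ (Fin n) → ℝ}
    {b : Fin n → EuclideanSpace ℝ (Fin n) → ℝ} (ha : ContDiff ℝ 2 a) (hb : ∀ i, ContDiff ℝ 1 (b i))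
    (hab : ∀ x, ∑ i, (pderiv i (pderiv i a) x + pderiv i (b i) x) = a x)
    (hη : ContDiff ℝ 1 η) (hc : HasCompactSupport η) :
    ∫ x, η x ^ 2 * Real.exp (V x) * a x ^ 2 ≤
      2 * ∑ i, (∫ x, pderiv i η x ^ 2 * Real.exp (V x) * a x ^ 2) +
      1 / 2 * ∑ i, ∫ x, η x ^ 2 * Real.exp (V x) * (b i x - a x * pderiv i V x) ^ 2 := by
  have hV1 : ContDiff ℝ 1 V := hV.of_le (by norm_num)
  have ha1 : ContDiff ℝ 1 a := ha.of_le (by norm_num)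
  have hda := fun i => ha.pderiv (l := 1) (by norm_num) i
  have hdV := fun i => (hV.pderiv (l := 1) (by norm_num) i).continuous
  have hdη := fun i => (hη.pderiv (l := 0) (by norm_num) i).continuous
  have i0 : Integrable (fun x => η x ^ 2 * Real.exp (V x) * a x ^ 2) volume :=
    integrable_sq_mul_mul_sq hη.continuous hc hV.continuous.rexp ha.continuous
  have i1 : ∀ i, Integrable (fun x => pderiv i η x ^ 2 * Real.exp (V x) * a x ^ 2) volume :=
    fun i => integrable_sq_mul_mul_sq (hdη i) (hc.pderiv i) hV.continuous.rexp ha.continuous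
  have i2 : ∀ i, Integrable
      (fun x => η x ^ 2 * Real.exp (V x) * (b i x - a x * pderiv i V x) ^ 2) volume :=
    fun i => integrable_sq_mul_mul_sq hη.continuous hc hV.continuous.rexp
      ((hb i).continuous.sub (ha.continuous.mul (hdV i)))
  obtain ⟨Z, hZ⟩ : ∃ Z : Fin n → EuclideanSpace ℝ (Fin n) → ℝ, ∀ i,
    Z i = fun y => η y * (η y * (a y * Real.exp (V y))) * (pderiv i a y + b i y) := ⟨_, fun _ => rfl⟩
  have hZ1 : ∀ i, ContDiff ℝ 1 (Z i) := fun i => by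
    rw [hZ]
    exact (hη.mul (hη.mul (ha1.mul hV1.exp))).mul ((hda i).add (hb i))
  have hZc : ∀ i, HasCompactSupport (Z i) := fun i => by
    rw [hZ]
    exact (hc.mul_right).mul_right
  have i3 : ∀ i, Integrable (pderiv i (Z i)) volume := fun i =>
    ((hZ1 i).pderiv (l := 0) (by norm_num) i).continuous.integrable_of_hasCompactSupport
      ((hZc i).pderiv i)
  have hz : ∀ i, ∫ x, pderiv i (Z i) x = 0 := fun i => integral_pderiv_eq_zero (hZ1 i) (hZc i)
  have i4 : ∀ i, Integrable (fun x => 2 * (pderiv i η x ^ 2 * Real.exp (V x) * a x ^ 2) +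
      1 / 2 * (η x ^ 2 * Real.exp (V x) * (b i x - a x * pderiv i V x) ^ 2)) volume :=
    fun i => ((i1 i).const_mul _).add ((i2 i).const_mul _)
  have i5 : ∀ i, Integrable (fun x => pderiv i (Z i) x +
      (2 * (pderiv i η x ^ 2 * Real.exp (V x) * a x ^ 2) +
      1 / 2 * (η x ^ 2 * Real.exp (V x) * (b i x - a x * pderiv i V x) ^ 2))) volume :=
    fun i => (i3 i).add (i4 i)
  have hpt : ∀ x, η x ^ 2 * Real.exp (V x) * a x ^ 2 ≤ ∑ i, (pderiv i (Z i) x +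
      (2 * (pderiv i η x ^ 2 * Real.exp (V x) * a x ^ 2) +
      1 / 2 * (η x ^ 2 * Real.exp (V x) * (b i x - a x * pderiv i V x) ^ 2))) := by
    intro x
    rw [sq (a x), ← mul_assoc]
    -- The equation is meant to replace one factor `a x` only. The rewrite changes both, and `hab x`
    -- below restores the other.
    conv_lhs => rw [← hab x, Finset.mul_sum]
    refine Finset.sum_le_sum fun i _ => ?_
    rw [hZ, hab x, ← sq]
    exact cutoff_energy_le_pderiv hV1 ha (hb i) hη i x
  refine (integral_mono i0 (integrable_finsetSum _ fun i _ => i5 i) hpt).trans_eq ?_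
  rw [integral_finsetSum _ fun i _ => i5 i, Finset.mul_sum, Finset.mul_sum,
    ← Finset.sum_add_distrib]
  refine Finset.sum_congr rfl fun i _ => ?_
  rw [integral_add (i3 i) (i4 i), hz, zero_add,
    integral_add ((i1 i).const_mul _) ((i2 i).const_mul _), integral_const_mul,
    integral_const_mul]

end WeakEquation

/-! ### Removing the mollification from the Caccioppoli inequality. -/

section Uniqueness

open Filter Topology Metric ContinuousLinearMap
open scoped Convolution ENNReal

variable {n : ℕ} {V : EuclideanSpace ℝ (Fin n) → ℝ}

theorem locallyIntegrable_of_memLp_closedBall {g : EuclideanSpace ℝ (Fin n) → ℝ}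
    (hg : ∀ R, MemLp g 2 (volume.restrict (closedBall 0 R))) : LocallyIntegrable g volume := by
  refine locallyIntegrable_iff.2 fun K hK => ?_
  obtain ⟨R, hR⟩ := hK.isBounded.subset_closedBall 0
  have : IsFiniteMeasure (volume.restrict (closedBall (0 : EuclideanSpace ℝ (Fin n)) R)) :=
    isFiniteMeasure_restrict.2 measure_closedBall_lt_top.ne
  have h : IntegrableOn g (closedBall 0 R) volume := (hg R).integrable (by norm_num)
  exact h.mono_set hR

theorem exists_bound_closedBall {c : EuclideanSpace ℝ (Fin n) → ℝ} (hc : Continuous c) (R : ℝ) :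
    ∃ M, 0 ≤ M ∧ ∀ x ∈ closedBall 0 R, |c x| ≤ M := by
  obtain ⟨M, hM⟩ := (isCompact_closedBall (0 : EuclideanSpace ℝ (Fin n)) R).exists_bound_of_continuousOn
    hc.continuousOn
  exact ⟨max M 0, le_max_right _ _, fun x hx => (hM x hx).trans (le_max_left _ _)⟩

theorem MeasureTheory.MemLp.mul_continuous_closedBall {g c : EuclideanSpace ℝ (Fin n) → ℝ} {R : ℝ}
    (hg : MemLp g 2 (volume.restrict (closedBall 0 R))) (hc : Continuous c) :
    MemLp (fun x => g x * c x) 2 (volume.restrict (closedBall 0 R)) := by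
  obtain ⟨M, -, hM⟩ := exists_bound_closedBall hc R
  refine hg.of_le_mul (c := M) (hg.1.mul hc.aestronglyMeasurable) ?_
  filter_upwards [ae_restrict_mem measurableSet_closedBall] with x hx
  rw [norm_mul, mul_comm]
  exact mul_le_mul_of_nonneg_right (hM x hx) (norm_nonneg _)

theorem Continuous.memLp_closedBall {c : EuclideanSpace ℝ (Fin n) → ℝ} (hc : Continuous c) (R : ℝ) :
    MemLp c 2 (volume.restrict (closedBall 0 R)) := by
  have : IsFiniteMeasure (volume.restrict (closedBall (0 : EuclideanSpace ℝ (Fin n)) R)) :=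
    isFiniteMeasure_restrict.2 measure_closedBall_lt_top.ne
  simpa using (memLp_const (1 : ℝ)).mul_continuous_closedBall (R := R) hc

/-- Pointwise, `2w² + 2(u - w)² - u² = (u - 2w)²`. This exchanges `v` and its mollification inside
weighted integrals, at the cost of a factor 2. -/
theorem integral_mul_sq_le_two_mul {c u w : EuclideanSpace ℝ (Fin n) → ℝ} {R M : ℝ}
    (hc : Continuous c) (hc0 : ∀ x, 0 ≤ c x) (hcM : ∀ x ∈ closedBall 0 R, c x ≤ M)
    (hsupp : ∀ x ∉ closedBall 0 R, c x = 0)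
    (hu : MemLp u 2 (volume.restrict (closedBall 0 R)))
    (hw : MemLp w 2 (volume.restrict (closedBall 0 R))) :
    ∫ x, c x * u x ^ 2 ≤
      2 * (∫ x, c x * w x ^ 2) + 2 * M * ∫ x in closedBall 0 R, (u x - w x) ^ 2 := by
  have hint : ∀ {u : EuclideanSpace ℝ (Fin n) → ℝ},
      MemLp u 2 (volume.restrict (closedBall 0 R)) →
      Integrable (fun x => c x * u x ^ 2) (volume.restrict (closedBall 0 R)) := by
    intro u hu
    have := (hu.mul_continuous_closedBall hc).integrable_mul hu
    refine this.congr (Eventually.of_forall fun x => ?_)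
    simp only [Pi.mul_apply]
    ring
  have hset : ∀ u : EuclideanSpace ℝ (Fin n) → ℝ,
      ∫ x, c x * u x ^ 2 = ∫ x in closedBall 0 R, c x * u x ^ 2 := fun u =>
    (setIntegral_eq_integral_of_forall_compl_eq_zero fun x hx => by rw [hsupp x hx, zero_mul]).symm
  have hsub : Integrable (fun x => (u x - w x) ^ 2) (volume.restrict (closedBall 0 R)) :=
    (hu.sub hw).integrable_sq
  rw [hset, hset, ← integral_const_mul, ← integral_const_mul,
    ← integral_add ((hint hw).const_mul _) (hsub.const_mul _)]
  refine setIntegral_mono_on (hint hu) (((hint hw).const_mul _).add (hsub.const_mul _))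
    measurableSet_closedBall fun x hx => ?_
  have h1 := mul_nonneg (hc0 x) (sq_nonneg (u x - 2 * w x))
  have h2 := mul_le_mul_of_nonneg_right (hcM x hx) (sq_nonneg (u x - w x))
  linarith

/-- With `F = v m`, one has `b - a m = (b - F) - (a - v) m`. No derivative falls on this commutator
in the Caccioppoli inequality, so plain `L²` convergence of `a` and `b` makes it vanish. -/
theorem integral_mul_commutator_sq_le {c a b v F m : EuclideanSpace ℝ (Fin n) → ℝ} {R M : ℝ}
    (hM : 0 ≤ M) (hc : Continuous c) (hc0 : ∀ x, 0 ≤ c x) (hcM : ∀ x ∈ closedBall 0 R, c x ≤ M)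
    (hsupp : ∀ x ∉ closedBall 0 R, c x = 0) (hm : Continuous m)
    (hmM : ∀ x ∈ closedBall 0 R, m x ^ 2 ≤ M)
    (ha : MemLp a 2 (volume.restrict (closedBall 0 R)))
    (hb : MemLp b 2 (volume.restrict (closedBall 0 R)))
    (hv : MemLp v 2 (volume.restrict (closedBall 0 R))) (hF : F = fun x => v x * m x) :
    ∫ x, c x * (b x - a x * m x) ^ 2 ≤ 2 * M *
      (2 * (∫ x in closedBall 0 R, (b x - F x) ^ 2) +
        2 * M * ∫ x in closedBall 0 R, (a x - v x) ^ 2) := by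
  have hF2 : MemLp F 2 (volume.restrict (closedBall 0 R)) :=
    hF ▸ hv.mul_continuous_closedBall hm
  have ham := ha.mul_continuous_closedBall hm
  have h1 := integral_mul_sq_le_two_mul (u := fun x => b x - a x * m x) (w := 0) hc hc0 hcM hsupp
    (hb.sub ham) MemLp.zero
  simp only [Pi.zero_apply, ne_eq, OfNat.ofNat_ne_zero, not_false_eq_true, zero_pow, mul_zero,
    integral_zero, zero_add, sub_zero] at h1
  refine h1.trans (mul_le_mul_of_nonneg_left ?_ (by positivity))
  have i1 : Integrable (fun x => (b x - F x) ^ 2) (volume.restrict (closedBall 0 R)) :=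
    (hb.sub hF2).integrable_sq
  have i2 : Integrable (fun x => (a x - v x) ^ 2) (volume.restrict (closedBall 0 R)) :=
    (ha.sub hv).integrable_sq
  have i3 : Integrable (fun x => (b x - a x * m x) ^ 2) (volume.restrict (closedBall 0 R)) :=
    (hb.sub ham).integrable_sq
  rw [← integral_const_mul, ← integral_const_mul, ← integral_add (i1.const_mul _) (i2.const_mul _)]
  refine setIntegral_mono_on i3 ((i1.const_mul _).add (i2.const_mul _))
    measurableSet_closedBall fun x hx => ?_
  have h2 := mul_le_mul_of_nonneg_right (hmM x hx) (sq_nonneg (a x - v x))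
  have h3 := sq_nonneg ((b x - F x) + (a x - v x) * m x)
  rw [hF] at h3 ⊢
  simp only at h3 ⊢
  linarith

/-- The Caccioppoli inequality for weak solutions `v` of `Δv + div (v ∇V) = v`. -/
theorem integral_cutoff_sq_le_of_weak (hV : ContDiff ℝ 2 V) {v η : EuclideanSpace ℝ (Fin n) → ℝ}
    (hvm : Measurable v) (hv : ∀ R, MemLp v 2 (volume.restrict (closedBall 0 R)))
    (hw : ∀ φ ∈ smoothCompact n, ∫ x, v x * (weightedLaplacian V φ x - φ x) = 0)
    (hη : ContDiff ℝ 1 η) {R : ℝ} (hsupp : tsupport η ⊆ closedBall 0 R) :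
    ∫ x, η x ^ 2 * Real.exp (V x) * v x ^ 2 ≤
      8 * ∑ i, ∫ x, pderiv i η x ^ 2 * Real.exp (V x) * v x ^ 2 := by
  have hc : HasCompactSupport η :=
    (isCompact_closedBall _ _).of_isClosed_subset (isClosed_tsupport η) hsupp
  have hdV := fun i => (hV.pderiv (l := 1) (by norm_num) i).continuous
  have hdη := fun i => (hη.pderiv (l := 0) (by norm_num) i).continuous
  have hli := locallyIntegrable_of_memLp_closedBall hv
  let F : Fin n → EuclideanSpace ℝ (Fin n) → ℝ := fun i x => v x * pderiv i V x
  have hF : ∀ i R, MemLp (F i) 2 (volume.restrict (closedBall 0 R)) := fun i R =>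
    (hv R).mul_continuous_closedBall (hdV i)
  have hFm : ∀ i, Measurable (F i) := fun i => hvm.mul (hdV i).measurable
  have hFli := fun i => locallyIntegrable_of_memLp_closedBall (hF i)
  have hc1 : Continuous fun x => η x ^ 2 * Real.exp (V x) :=
    (hη.continuous.pow 2).mul hV.continuous.rexp
  have hc2 : ∀ i, Continuous fun x => pderiv i η x ^ 2 * Real.exp (V x) := fun i =>
    ((hdη i).pow 2).mul hV.continuous.rexp
  have hs1 : ∀ x ∉ closedBall 0 R, η x ^ 2 * Real.exp (V x) = 0 := fun x hx => by
    rw [image_eq_zero_of_notMem_tsupport fun h => hx (hsupp h)]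
    simp
  have hs2 : ∀ i, ∀ x ∉ closedBall 0 R, pderiv i η x ^ 2 * Real.exp (V x) = 0 := fun i x hx => by
    have : pderiv i η x = 0 := image_eq_zero_of_notMem_tsupport fun h =>
      hx (hsupp (tsupport_fderiv_apply_subset ℝ _ h))
    rw [this]
    simp
  obtain ⟨M, hM0, hM1, hM2, hM3⟩ : ∃ M : ℝ, 0 ≤ M ∧
      (∀ x ∈ closedBall 0 R, η x ^ 2 * Real.exp (V x) ≤ M) ∧
      (∀ i, ∀ x ∈ closedBall 0 R, pderiv i η x ^ 2 * Real.exp (V x) ≤ M) ∧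
      (∀ i, ∀ x ∈ closedBall 0 R, pderiv i V x ^ 2 ≤ M) := by
    -- A single bound for a sum of nonnegative continuous functions controls every summand.
    obtain ⟨M, hM0, hM⟩ := exists_bound_closedBall (R := R) (c := fun x =>
      η x ^ 2 * Real.exp (V x) +
        ∑ i, (pderiv i η x ^ 2 * Real.exp (V x) + pderiv i V x ^ 2))
      (hc1.add (continuous_finsetSum _ fun i _ => (hc2 i).add ((hdV i).pow 2)))
    have key : ∀ i, ∀ x, pderiv i η x ^ 2 * Real.exp (V x) + pderiv i V x ^ 2 ≤
        ∑ i, (pderiv i η x ^ 2 * Real.exp (V x) + pderiv i V x ^ 2) := fun i x =>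
      Finset.single_le_sum (f := fun i => pderiv i η x ^ 2 * Real.exp (V x) + pderiv i V x ^ 2)
        (fun i _ => by positivity) (Finset.mem_univ i)
    have p1 : ∀ x, 0 ≤ η x ^ 2 * Real.exp (V x) := fun x => by positivity
    have p2 : ∀ i x, 0 ≤ pderiv i η x ^ 2 * Real.exp (V x) := fun i x => by positivity
    have p3 : ∀ x, 0 ≤ ∑ i, (pderiv i η x ^ 2 * Real.exp (V x) + pderiv i V x ^ 2) :=
      fun x => Finset.sum_nonneg fun i _ => by positivity
    refine ⟨M, hM0, fun x hx => ?_, fun i x hx => ?_, fun i x hx => ?_⟩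
    · linarith [le_of_abs_le (hM x hx), p3 x]
    · linarith [le_of_abs_le (hM x hx), p1 x, key i x, sq_nonneg (pderiv i V x)]
    · linarith [le_of_abs_le (hM x hx), p1 x, key i x, p2 i x]
  let φ : ℕ → ContDiffBump (0 : EuclideanSpace ℝ (Fin n)) := fun k =>
    ⟨1 / (k + 1) / 2, 1 / (k + 1), by positivity, half_lt_self (by positivity)⟩
  have hφ : Tendsto (fun k => (φ k).rOut) atTop (𝓝 0) := tendsto_one_div_add_atTop_nhds_zero_nat
  let a : ℕ → EuclideanSpace ℝ (Fin n) → ℝ := fun k =>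
    (φ k).normed volume ⋆[lsmul ℝ ℝ, volume] v
  let b : ℕ → Fin n → EuclideanSpace ℝ (Fin n) → ℝ := fun k i =>
    (φ k).normed volume ⋆[lsmul ℝ ℝ, volume] F i
  have ha : ∀ k, ContDiff ℝ 2 (a k) := fun k =>
    (φ k).hasCompactSupport_normed.contDiff_convolution_left (n := 2) (lsmul ℝ ℝ)
      (φ k).contDiff_normed hli
  have hb : ∀ k i, ContDiff ℝ 1 (b k i) := fun k i =>
    (φ k).hasCompactSupport_normed.contDiff_convolution_left (n := 1) (lsmul ℝ ℝ)
      (φ k).contDiff_normed (hFli i)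
  have hta := tendsto_setIntegral_normed_convolution_sub_sq hvm hli hv hφ R
  have htb := fun i => tendsto_setIntegral_normed_convolution_sub_sq (hFm i) (hFli i) (hF i) hφ R
  -- The constant is `8 = 2 · 2 · 2`: one factor for passing from `v` to `a k`, one from the smooth
  -- Caccioppoli inequality, one for returning to `v`. The remaining terms tend to zero.
  have hmain : ∀ k, ∫ x, η x ^ 2 * Real.exp (V x) * v x ^ 2 ≤
      8 * (∑ i, ∫ x, pderiv i η x ^ 2 * Real.exp (V x) * v x ^ 2) +
      ((∑ i : Fin n, (8 * M * (∫ x in closedBall 0 R, (a k x - v x) ^ 2) +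
        2 * M * (2 * (∫ x in closedBall 0 R, (b k i x - F i x) ^ 2) +
          2 * M * ∫ x in closedBall 0 R, (a k x - v x) ^ 2))) +
        2 * M * ∫ x in closedBall 0 R, (a k x - v x) ^ 2) := by
    intro k
    have haR := (ha k).continuous.memLp_closedBall R
    have h1 := integral_mul_sq_le_two_mul hc1 (fun x => by positivity) hM1 hs1 (hv R) haR
    have h2 := integral_cutoff_sq_le hV (ha k) (hb k)
      (sum_pderiv_convolution_eq hV hli hw (φ k).contDiff_normed
        (φ k).hasCompactSupport_normed) hη hc
    have h3 := fun i => integral_mul_sq_le_two_mul (hc2 i) (fun x => by positivity) (hM2 i) (hs2 i)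
      haR (hv R)
    have h4 := fun i => integral_mul_commutator_sq_le hM0 hc1 (fun x => by positivity) hM1 hs1
      (hdV i) (hM3 i) haR ((hb k i).continuous.memLp_closedBall R) (hv R) (rfl : F i = _)
    have hsymm : ∫ x in closedBall 0 R, (v x - a k x) ^ 2 =
        ∫ x in closedBall 0 R, (a k x - v x) ^ 2 := by
      congr 1 with x
      ring
    rw [hsymm] at h1
    have h5 := Finset.sum_le_sum fun i (_ : i ∈ Finset.univ) => h3 i
    have h6 := Finset.sum_le_sum fun i (_ : i ∈ Finset.univ) => h4 i
    simp only [Finset.sum_add_distrib, ← Finset.mul_sum] at h5 h6 ⊢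
    linarith
  have hlim : Tendsto (fun k =>
      8 * (∑ i, ∫ x, pderiv i η x ^ 2 * Real.exp (V x) * v x ^ 2) +
      ((∑ i : Fin n, (8 * M * (∫ x in closedBall 0 R, (a k x - v x) ^ 2) +
        2 * M * (2 * (∫ x in closedBall 0 R, (b k i x - F i x) ^ 2) +
          2 * M * ∫ x in closedBall 0 R, (a k x - v x) ^ 2))) +
        2 * M * ∫ x in closedBall 0 R, (a k x - v x) ^ 2)) atTop
      (𝓝 (8 * (∑ i, ∫ x, pderiv i η x ^ 2 * Real.exp (V x) * v x ^ 2) +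
        ((∑ i : Fin n, (8 * M * 0 + 2 * M * (2 * 0 + 2 * M * 0))) + 2 * M * 0))) :=
    tendsto_const_nhds.add ((tendsto_finsetSum _ fun i _ => (hta.const_mul _).add
      (((htb i).const_mul _).add (hta.const_mul _) |>.const_mul _)).add (hta.const_mul _))
  simpa using ge_of_tendsto' hlim hmain

end Uniqueness

/-! ### Vanishing of `L²(μ)` functions orthogonal to the range of `L - 1`. -/

section Density

open Filter Topology Metric

variable {n : ℕ} {V : EuclideanSpace ℝ (Fin n) → ℝ}

/-- The function `h e^{-V/2}` is square integrable for Lebesgue measure, and `e^{V/2}` is bounded on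
balls. -/
theorem memLp_closedBall_of_gibbsMeasure (hV : Continuous V) (h : Lp ℝ 2 (gibbsMeasure V)) (R : ℝ) :
    MemLp h 2 (volume.restrict (closedBall 0 R)) := by
  have hm := (Lp.stronglyMeasurable h).measurable
  have h1 : MemLp (fun x => h x * Real.exp (-V x / 2)) 2 volume := by
    have hm' : Measurable fun x => h x * Real.exp (-V x / 2) :=
      hm.mul (hV.neg.div_const 2).rexp.measurable
    rw [memLp_two_iff_integrable_sq hm'.aestronglyMeasurable]
    refine ((integrable_gibbsMeasure_iff hV).1 (Lp.memLp h).integrable_sq).congr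
      (Eventually.of_forall fun x => ?_)
    simp only
    rw [mul_pow, ← Real.exp_nat_mul]
    push_cast
    rw [mul_div_cancel₀ _ two_ne_zero, mul_comm]
  have h2 := (h1.restrict (closedBall 0 R)).mul_continuous_closedBall (hV.div_const 2).rexp
  refine h2.congr_norm hm.aestronglyMeasurable (Eventually.of_forall fun x => ?_)
  rw [mul_assoc, ← Real.exp_add, neg_div, neg_add_cancel, Real.exp_zero, mul_one]

theorem locallyIntegrable_of_gibbsMeasure (hV : Continuous V) (h : Lp ℝ 2 (gibbsMeasure V)) :
    LocallyIntegrable h volume :=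
  locallyIntegrable_of_memLp_closedBall (memLp_closedBall_of_gibbsMeasure hV h)

theorem pderiv_comp_smul {g : EuclideanSpace ℝ (Fin n) → ℝ} (c : ℝ)
    (i : Fin n) (x : EuclideanSpace ℝ (Fin n)) :
    pderiv i (fun y => g (c • y)) x = c * pderiv i g (c • x) := by
  simp [pderiv, fderiv_comp_smul]

/-- Every `w` satisfying Caccioppoli inequalities for all cutoffs vanishes. -/
theorem ae_eq_zero_of_integral_cutoff_le {w : EuclideanSpace ℝ (Fin n) → ℝ} (hw : Integrable w volume)
    (hw0 : ∀ x, 0 ≤ w x) (h : ∀ η : EuclideanSpace ℝ (Fin n) → ℝ, ContDiff ℝ 1 η →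
      HasCompactSupport η → ∫ x, η x ^ 2 * w x ≤ 8 * ∑ i, ∫ x, pderiv i η x ^ 2 * w x) :
    w =ᵐ[volume] 0 := by
  let χ : ContDiffBump (0 : EuclideanSpace ℝ (Fin n)) := ⟨1, 2, one_pos, one_lt_two⟩
  have hχ : ContDiff ℝ 1 χ := χ.contDiff
  have hχ' := fun i => (hχ.pderiv (l := 0) (by norm_num) i).continuous
  obtain ⟨M, hM⟩ : ∃ M, ∀ i, ∀ x, |pderiv i χ x| ≤ M := by
    choose M hM using fun i => (hχ' i).bounded_above_of_compact_support
      (χ.hasCompactSupport.pderiv i)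
    exact ⟨∑ i, |M i|, fun i x => (hM i x).trans ((le_abs_self _).trans
      (Finset.single_le_sum (f := fun i => |M i|) (fun i _ => abs_nonneg _) (Finset.mem_univ i)))⟩
  let c : ℕ → ℝ := fun k => 1 / ((k : ℝ) + 1)
  have hc : Tendsto c atTop (𝓝 0) := tendsto_one_div_add_atTop_nhds_zero_nat
  have hc0 : ∀ k, c k ≠ 0 := fun k => by positivity
  let η : ℕ → EuclideanSpace ℝ (Fin n) → ℝ := fun k x => χ (c k • x)
  have hη : ∀ k, ContDiff ℝ 1 (η k) := fun k => hχ.comp (contDiff_const_smul (c k))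
  have hηc : ∀ k, HasCompactSupport (η k) := fun k =>
    χ.hasCompactSupport.comp_homeomorph (Homeomorph.smulOfNeZero (c k) (hc0 k))
  -- Dilating the cutoff by `k + 1` divides its gradient by `k + 1`. As `w` is integrable, the right
  -- side tends to zero while the left tends to `∫ w`, whatever the growth of `V`.
  have hbd : ∀ k, ∫ x, η k x ^ 2 * w x ≤ 8 * ∑ _i : Fin n, (c k * M) ^ 2 * ∫ x, w x := by
    intro k
    refine (h (η k) (hη k) (hηc k)).trans (mul_le_mul_of_nonneg_left
      (Finset.sum_le_sum fun i _ => ?_) (by norm_num))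
    rw [← integral_const_mul]
    refine integral_mono_of_nonneg (Eventually.of_forall fun x => mul_nonneg (sq_nonneg _) (hw0 x))
      (hw.const_mul _) (Eventually.of_forall fun x => mul_le_mul_of_nonneg_right ?_ (hw0 x))
    rw [pderiv_comp_smul, mul_pow, mul_pow]
    refine mul_le_mul_of_nonneg_left ?_ (sq_nonneg _)
    rw [← sq_abs]
    exact pow_le_pow_left₀ (abs_nonneg _) (hM i _) 2
  have hlim : Tendsto (fun k => ∫ x, η k x ^ 2 * w x) atTop (𝓝 (∫ x, w x)) := by
    refine tendsto_integral_of_dominated_convergence w (fun k =>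
      ((hη k).continuous.pow 2).aestronglyMeasurable.mul hw.1) hw
      (fun k => Eventually.of_forall fun x => ?_) (Eventually.of_forall fun x => ?_)
    · rw [norm_mul, Real.norm_of_nonneg (hw0 x), Real.norm_of_nonneg (sq_nonneg _)]
      exact mul_le_of_le_one_left (hw0 x) (pow_le_one₀ χ.nonneg χ.le_one)
    · have h1 : Tendsto (fun k => η k x) atTop (𝓝 (χ ((0 : ℝ) • x))) :=
        (hχ.continuous.tendsto _).comp (hc.smul_const x)
      have h2 : χ ((0 : ℝ) • x) = 1 := by
        rw [zero_smul]
        exact χ.one_of_mem_closedBall (mem_closedBall_self zero_le_one)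
      rw [h2] at h1
      simpa using (h1.pow 2).mul_const (w x)
  have hlim2 : Tendsto (fun k => 8 * ∑ _i : Fin n, (c k * M) ^ 2 * ∫ x, w x) atTop
      (𝓝 (8 * ∑ _i : Fin n, (0 * M) ^ 2 * ∫ x, w x)) :=
    (tendsto_finsetSum _ fun i _ => ((hc.mul_const M).pow 2).mul_const _).const_mul 8
  have hle := le_of_tendsto_of_tendsto' hlim hlim2 hbd
  have h0 : ∫ x, w x = 0 := le_antisymm (by simpa using hle) (integral_nonneg hw0)
  exact (integral_eq_zero_iff_of_nonneg hw0 hw).1 h0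

theorem eq_zero_of_integral_weightedLaplacian_sub (hV : ContDiff ℝ 2 V)
    (h : Lp ℝ 2 (gibbsMeasure V))
    (hw : ∀ φ ∈ smoothCompact n,
      ∫ x, h x * (weightedLaplacian V φ x - φ x) ∂(gibbsMeasure V) = 0) : h = 0 := by
  have hc := hV.continuous
  have hm := (Lp.stronglyMeasurable h).measurable
  let v : EuclideanSpace ℝ (Fin n) → ℝ := fun x => h x * Real.exp (-V x)
  have hvm : Measurable v := hm.mul hc.neg.rexp.measurable
  have hv : ∀ R, MemLp v 2 (volume.restrict (closedBall 0 R)) := fun R =>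
    (memLp_closedBall_of_gibbsMeasure hc h R).mul_continuous_closedBall hc.neg.rexp
  have hweak : ∀ φ ∈ smoothCompact n, ∫ x, v x * (weightedLaplacian V φ x - φ x) = 0 := by
    intro φ hφ
    rw [← hw φ hφ, integral_gibbsMeasure hc]
    congr 1 with x
    simp only [v]
    ring
  have hvw : ∀ x, Real.exp (V x) * v x ^ 2 = Real.exp (-V x) * h x ^ 2 := fun x => by
    simp only [v]
    rw [Real.exp_neg]
    field_simp
  -- By `hvw` the Caccioppoli weight `e^V v²` is `e^{-V} h²`, whose integrability is exactly `h ∈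
  -- L²(μ)`.
  have hz : (fun x => Real.exp (-V x) * h x ^ 2) =ᵐ[volume] 0 := by
    refine ae_eq_zero_of_integral_cutoff_le
      ((integrable_gibbsMeasure_iff hc).1 (Lp.memLp h).integrable_sq)
      (fun x => by positivity) fun η hη hηc => ?_
    obtain ⟨R, hR⟩ := hηc.isBounded.subset_closedBall 0
    have := integral_cutoff_sq_le_of_weak hV hvm hv hweak hη hR
    simpa only [mul_assoc, hvw] using this
  rw [Lp.eq_zero_iff_ae_eq_zero]
  refine (withDensity_absolutelyContinuous _ _).ae_le (hz.mono fun x hx => ?_)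
  simpa using hx

end Density

/-! ### The core property and passage to the limit in `L²(μ)`. -/

section Closure

open Filter Topology

variable {n : ℕ} {V : EuclideanSpace ℝ (Fin n) → ℝ}

theorem smoothCompact_contDiff {φ : EuclideanSpace ℝ (Fin n) → ℝ} (hφ : φ ∈ smoothCompact n)
    (m : ℕ) : ContDiff ℝ m φ :=
  hφ.1.of_le (WithTop.coe_le_coe.2 le_top)

theorem inner_toLp {μ : Measure (EuclideanSpace ℝ (Fin n))} {g : EuclideanSpace ℝ (Fin n) → ℝ}
    (hg : MemLp g 2 μ) (u : Lp ℝ 2 μ) : inner ℝ (hg.toLp g) u = ∫ x, u x * g x ∂μ := by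
  rw [L2.inner_def]
  refine integral_congr_ae ?_
  filter_upwards [hg.coeFn_toLp] with x hx
  rw [hx]
  rfl

theorem inner_toLp_toLp {μ : Measure (EuclideanSpace ℝ (Fin n))}
    {g k : EuclideanSpace ℝ (Fin n) → ℝ} (hg : MemLp g 2 μ) (hk : MemLp k 2 μ) :
    inner ℝ (hg.toLp g) (hk.toLp k) = ∫ x, g x * k x ∂μ := by
  rw [inner_toLp]
  refine integral_congr_ae ?_
  filter_upwards [hk.coeFn_toLp] with x hx
  rw [hx, mul_comm]

theorem norm_toLp_sq {μ : Measure (EuclideanSpace ℝ (Fin n))} {g : EuclideanSpace ℝ (Fin n) → ℝ}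
    (hg : MemLp g 2 μ) : ‖hg.toLp g‖ ^ 2 = ∫ x, g x ^ 2 ∂μ := by
  rw [← real_inner_self_eq_norm_sq, inner_toLp_toLp]
  simp only [sq]

theorem norm_Lp_sq {μ : Measure (EuclideanSpace ℝ (Fin n))} (u : Lp ℝ 2 μ) :
    ‖u‖ ^ 2 = ∫ x, u x ^ 2 ∂μ := by
  rw [← real_inner_self_eq_norm_sq, L2.inner_def]
  simp [sq]

theorem inner_smoothCompactToLp_weightedLaplacianToLp (hV : ContDiff ℝ 2 V)
    (φ ψ : smoothCompact n) :
    inner ℝ (smoothCompactToLp hV φ) (weightedLaplacianToLp hV ψ) =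
      -∑ i, ∫ x, pderiv i ψ.1 x * pderiv i φ.1 x ∂(gibbsMeasure V) :=
  (inner_toLp_toLp (memLp_gibbsMeasure hV.continuous φ.2.1.continuous φ.2.2)
    (memLp_weightedLaplacian hV ψ.2)).trans (integral_mul_weightedLaplacian hV (smoothCompact_contDiff ψ.2 2)
    (smoothCompact_contDiff φ.2 1) ψ.2.2)

theorem inner_smoothCompactToLp_weightedLaplacianToLp_comm (hV : ContDiff ℝ 2 V)
    (φ ψ : smoothCompact n) :
    inner ℝ (smoothCompactToLp hV φ) (weightedLaplacianToLp hV ψ) =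
      inner ℝ (weightedLaplacianToLp hV φ) (smoothCompactToLp hV ψ) := by
  rw [inner_smoothCompactToLp_weightedLaplacianToLp, real_inner_comm,
    inner_smoothCompactToLp_weightedLaplacianToLp]
  simp only [mul_comm]

/-- Since `⟨φ, L φ⟩ ≤ 0`, expanding the square gives `‖L φ - φ‖² ≥ ‖L φ‖² + ‖φ‖²`. Hence convergence
of `(L - 1) u_k` makes `u_k` Cauchy. -/
theorem norm_smoothCompactToLp_le (hV : ContDiff ℝ 2 V) (φ : smoothCompact n) :
    ‖smoothCompactToLp hV φ‖ ≤ ‖weightedLaplacianToLp hV φ - smoothCompactToLp hV φ‖ := by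
  set a := smoothCompactToLp hV φ
  set b := weightedLaplacianToLp hV φ
  have h1 : inner ℝ a b ≤ 0 := by
    rw [inner_smoothCompactToLp_weightedLaplacianToLp, neg_nonpos]
    exact Finset.sum_nonneg fun i _ => integral_nonneg fun x => mul_self_nonneg _
  have h2 : ‖b - a‖ ^ 2 = ‖b‖ ^ 2 - 2 * inner ℝ a b + ‖a‖ ^ 2 := by
    rw [norm_sub_sq_real, real_inner_comm]
  refine le_of_sq_le_sq ?_ (norm_nonneg _)
  nlinarith [sq_nonneg ‖b‖]

theorem cauchySeq_map_of_norm_le {S A B : Type*} [AddCommGroup S] [Module ℝ S]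
    [NormedAddCommGroup A] [NormedSpace ℝ A] [NormedAddCommGroup B] [NormedSpace ℝ B]
    {F : S →ₗ[ℝ] A} {G : S →ₗ[ℝ] B} {c : ℝ} (h : ∀ s, ‖F s‖ ≤ c * ‖G s‖) {u : ℕ → S}
    (hu : CauchySeq fun k => G (u k)) : CauchySeq fun k => F (u k) := by
  rw [Metric.cauchySeq_iff] at hu ⊢
  intro ε hε
  -- The denominator stays positive although nothing is assumed on the sign of `c`.
  obtain ⟨N, hN⟩ := hu (ε / (|c| + 1)) (by positivity)
  refine ⟨N, fun k hk l hl => ?_⟩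
  have h1 := hN k hk l hl
  rw [dist_eq_norm, ← map_sub] at h1 ⊢
  rw [lt_div_iff₀ (by positivity)] at h1
  have h2 := h (u k - u l)
  have h3 := mul_le_mul_of_nonneg_right (le_abs_self c) (norm_nonneg (G (u k - u l)))
  nlinarith [norm_nonneg (G (u k - u l))]

theorem dense_range_weightedLaplacianToLp_sub (hV : ContDiff ℝ 2 V) :
    DenseRange (weightedLaplacianToLp hV - smoothCompactToLp hV) := by
  have h : Dense ((LinearMap.range (weightedLaplacianToLp hV - smoothCompactToLp hV) :
      Submodule ℝ (Lp ℝ 2 (gibbsMeasure V))) : Set (Lp ℝ 2 (gibbsMeasure V))) := by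
    rw [Submodule.dense_iff_topologicalClosure_eq_top, Submodule.topologicalClosure_eq_top_iff,
      Submodule.eq_bot_iff]
    intro u hu
    rw [Submodule.mem_orthogonal] at hu
    refine eq_zero_of_integral_weightedLaplacian_sub hV u fun φ hφ => ?_
    rw [← hu _ ⟨⟨φ, hφ⟩, rfl⟩]
    exact (inner_toLp ((memLp_weightedLaplacian hV hφ).sub
      (memLp_gibbsMeasure hV.continuous hφ.1.continuous hφ.2)) u).symm
  rwa [LinearMap.coe_range] at h

/-- Smooth compactly supported functions form a core of the Laplace operator. -/
theorem exists_smoothCompact_tendsto (hV : ContDiff ℝ 2 V) (f : (laplaceOperator hV).domain) :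
    ∃ u : ℕ → smoothCompact n,
      Tendsto (fun k => smoothCompactToLp hV (u k)) atTop (𝓝 (f : Lp ℝ 2 (gibbsMeasure V))) ∧
      Tendsto (fun k => weightedLaplacianToLp hV (u k)) atTop (𝓝 (laplaceOperator hV f)) := by
  set g := laplaceOperator hV f - (f : Lp ℝ 2 (gibbsMeasure V)) with hg
  have hadj : ∀ φ : smoothCompact n, inner ℝ (laplaceOperator hV f) (smoothCompactToLp hV φ) =
      inner ℝ (f : Lp ℝ 2 (gibbsMeasure V)) (weightedLaplacianToLp hV φ) := by
    intro φ
    have h := LinearPMap.adjoint_isFormalAdjoint (dense_laplaceCore_domain hV) f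
      ⟨smoothCompactToLp hV φ, ⟨φ, rfl⟩⟩
    refine h.trans ?_
    congr 1
    change weightedLaplacianToLp hV ((LinearEquiv.ofInjective (smoothCompactToLp hV)
      (smoothCompactToLp_injective hV)).symm ⟨smoothCompactToLp hV φ, ⟨φ, rfl⟩⟩) = _
    congr 1
    rw [LinearEquiv.symm_apply_eq]
    rfl
  -- Choose test functions with `(L - 1) u_k → L f - f`. They converge to some `f'` with `L u_k → L
  -- f - f + f'`, so it remains to identify `f'` with `f`.
  obtain ⟨w, hw, hlim⟩ := mem_closure_iff_seq_limit.1
    (dense_range_weightedLaplacianToLp_sub hV g)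
  choose u hu using hw
  obtain rfl : (fun k => (weightedLaplacianToLp hV - smoothCompactToLp hV) (u k)) = w := funext hu
  have hcau : CauchySeq fun k => smoothCompactToLp hV (u k) :=
    cauchySeq_map_of_norm_le (F := smoothCompactToLp hV)
      (G := weightedLaplacianToLp hV - smoothCompactToLp hV) (c := 1)
      (fun s => by simpa using norm_smoothCompactToLp_le hV s) hlim.cauchySeq
  obtain ⟨f', hf'⟩ := cauchySeq_tendsto_of_complete hcau
  have hL : Tendsto (fun k => weightedLaplacianToLp hV (u k)) atTop (𝓝 (g + f')) := by
    refine (hlim.add hf').congr fun k => ?_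
    simp
  -- Both `f` and `f'` satisfy the adjoint relation against test functions with the same value of `L
  -- - 1`, so `f - f'` is orthogonal to the range of `L - 1`.
  have hff : (f : Lp ℝ 2 (gibbsMeasure V)) = f' := by
    rw [← sub_eq_zero]
    refine eq_zero_of_integral_weightedLaplacian_sub hV _ fun φ hφ => ?_
    have h1 := inner_toLp ((memLp_weightedLaplacian hV hφ).sub
      (memLp_gibbsMeasure hV.continuous hφ.1.continuous hφ.2))
      ((f : Lp ℝ 2 (gibbsMeasure V)) - f')
    refine h1.symm.trans ?_
    rw [real_inner_comm]
    change inner ℝ ((f : Lp ℝ 2 (gibbsMeasure V)) - f')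
      (weightedLaplacianToLp hV ⟨φ, hφ⟩ - smoothCompactToLp hV ⟨φ, hφ⟩) = 0
    have h2 : inner ℝ f' (weightedLaplacianToLp hV ⟨φ, hφ⟩) =
        inner ℝ (g + f') (smoothCompactToLp hV ⟨φ, hφ⟩) :=
      tendsto_nhds_unique (hf'.inner tendsto_const_nhds)
        ((hL.inner tendsto_const_nhds).congr fun k =>
          (inner_smoothCompactToLp_weightedLaplacianToLp_comm hV (u k) ⟨φ, hφ⟩).symm)
    rw [inner_sub_left, inner_sub_right, inner_sub_right, h2, ← hadj, hg, inner_add_left,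
      inner_sub_left]
    ring
  refine ⟨u, hff ▸ hf', ?_⟩
  convert! hL using 2
  rw [hg, ← hff, sub_add_cancel]

theorem memLp_pderiv_pderiv (hV : ContDiff ℝ 2 V) (φ : smoothCompact n) (i j : Fin n) :
    MemLp (pderiv i (pderiv j φ.1)) 2 (gibbsMeasure V) :=
  memLp_gibbsMeasure hV.continuous
    (((smoothCompact_contDiff φ.2 2).pderiv (l := 1) (by norm_num) j).pderiv (l := 0)
      (by norm_num) i).continuous ((φ.2.2.pderiv j).pderiv i)

/-- The map `φ ↦ ∂ᵢ∂ⱼφ` from smooth compactly supported functions to `L²(μ)`. -/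
noncomputable def hessianToLp (hV : ContDiff ℝ 2 V) (i j : Fin n) :
    smoothCompact n →ₗ[ℝ] Lp ℝ 2 (gibbsMeasure V) where
  toFun φ := (memLp_pderiv_pderiv hV φ i j).toLp (pderiv i (pderiv j φ.1))
  map_add' φ ψ := by
    rw [← MemLp.toLp_add]
    refine MemLp.toLp_congr _ _ (Eventually.of_forall fun x => ?_)
    have dφ := fun y => (smoothCompact_contDiff φ.2 2).differentiable two_ne_zero y
    have dψ := fun y => (smoothCompact_contDiff ψ.2 2).differentiable two_ne_zero y
    have dφ' := ((smoothCompact_contDiff φ.2 2).pderiv (l := 1) (by norm_num) j).differentiable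
      one_ne_zero x
    have dψ' := ((smoothCompact_contDiff ψ.2 2).pderiv (l := 1) (by norm_num) j).differentiable
      one_ne_zero x
    have h : pderiv j (φ + ψ).1 = fun y => pderiv j φ.1 y + pderiv j ψ.1 y :=
      funext fun y => pderiv_add (dφ y) (dψ y)
    rw [h, pderiv_add dφ' dψ']
    rfl
  map_smul' c φ := by
    rw [RingHom.id_apply, ← MemLp.toLp_const_smul]
    refine MemLp.toLp_congr _ _ (Eventually.of_forall fun x => ?_)
    have dφ := fun y => (smoothCompact_contDiff φ.2 2).differentiable two_ne_zero y
    have dφ' := ((smoothCompact_contDiff φ.2 2).pderiv (l := 1) (by norm_num) j).differentiable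
      one_ne_zero x
    have h : pderiv j (c • φ).1 = c • pderiv j φ.1 :=
      funext fun y => pderiv_const_smul c (dφ y)
    rw [h, pderiv_const_smul c dφ']
    rfl

theorem sum_norm_hessianToLp_sq_le (hV : ContDiff ℝ 2 V) [IsProbabilityMeasure (gibbsMeasure V)]
    {C κ : ℝ} (hκ : 0 ≤ κ) (hP : SatisfiesPoincare (gibbsMeasure V) C) (hsc : IsSemiConvex V κ)
    (φ : smoothCompact n) :
    ∑ i, ∑ j, ‖hessianToLp hV i j φ‖ ^ 2 ≤ (1 + κ * C) * ‖weightedLaplacianToLp hV φ‖ ^ 2 := by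
  have h := hP.sum_integral_hessian_sq_le hV hκ hsc (smoothCompact_contDiff φ.2 3) φ.2.2
  have h1 : ‖weightedLaplacianToLp hV φ‖ ^ 2 = _ := norm_toLp_sq (memLp_weightedLaplacian hV φ.2)
  have h2 : ∀ i j, ‖hessianToLp hV i j φ‖ ^ 2 = _ := fun i j =>
    norm_toLp_sq (memLp_pderiv_pderiv hV φ i j)
  simpa only [h1, h2] using h

/-- Entrywise form needed for the Cauchy argument; the absolute value is there because `C` may be
negative. -/
theorem norm_hessianToLp_le (hV : ContDiff ℝ 2 V) [IsProbabilityMeasure (gibbsMeasure V)]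
    {C κ : ℝ} (hκ : 0 ≤ κ) (hP : SatisfiesPoincare (gibbsMeasure V) C) (hsc : IsSemiConvex V κ)
    (i j : Fin n) (φ : smoothCompact n) :
    ‖hessianToLp hV i j φ‖ ≤ Real.sqrt |1 + κ * C| * ‖weightedLaplacianToLp hV φ‖ := by
  have h := sum_norm_hessianToLp_sq_le hV hκ hP hsc φ
  have h1 : ‖hessianToLp hV i j φ‖ ^ 2 ≤ ∑ i, ∑ j, ‖hessianToLp hV i j φ‖ ^ 2 :=
    (Finset.single_le_sum (f := fun j => ‖hessianToLp hV i j φ‖ ^ 2) (fun j _ => sq_nonneg _)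
      (Finset.mem_univ j)).trans
    (Finset.single_le_sum (f := fun i => ∑ j, ‖hessianToLp hV i j φ‖ ^ 2)
      (fun i _ => Finset.sum_nonneg fun j _ => sq_nonneg _) (Finset.mem_univ i))
  refine le_of_sq_le_sq ?_ (by positivity)
  rw [mul_pow, Real.sq_sqrt (abs_nonneg _)]
  exact (h1.trans h).trans (mul_le_mul_of_nonneg_right (le_abs_self _) (sq_nonneg _))

/-- Weak derivatives are tested against Lebesgue measure, convergence holds in `L²(μ)`. The function
`ψ e^V`, in `L²(μ)` by compact support, links the two. -/
theorem integral_mul_eq_inner (hV : Continuous V) {ψ : EuclideanSpace ℝ (Fin n) → ℝ}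
    (hψ : Continuous ψ) (hc : HasCompactSupport ψ) :
    ∃ p : Lp ℝ 2 (gibbsMeasure V), ∀ u : Lp ℝ 2 (gibbsMeasure V),
      ∫ x, u x * ψ x = inner ℝ p u := by
  have hm : MemLp (fun x => ψ x * Real.exp (V x)) 2 (gibbsMeasure V) :=
    memLp_gibbsMeasure hV (hψ.mul hV.rexp) hc.mul_right
  refine ⟨hm.toLp _, fun u => ?_⟩
  rw [inner_toLp, integral_gibbsMeasure hV]
  congr 1 with x
  rw [Real.exp_neg]
  field_simp

theorem tendsto_integral_mul (hV : Continuous V) {ψ : EuclideanSpace ℝ (Fin n) → ℝ}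
    (hψ : Continuous ψ) (hc : HasCompactSupport ψ) {u : ℕ → Lp ℝ 2 (gibbsMeasure V)}
    {u₀ : Lp ℝ 2 (gibbsMeasure V)} (hu : Tendsto u atTop (𝓝 u₀)) :
    Tendsto (fun k => ∫ x, u k x * ψ x) atTop (𝓝 (∫ x, u₀ x * ψ x)) := by
  obtain ⟨p, hp⟩ := integral_mul_eq_inner hV hψ hc
  simp only [hp]
  exact tendsto_const_nhds.inner hu

theorem integral_toLp_mul (hV : Continuous V) {g : EuclideanSpace ℝ (Fin n) → ℝ}
    (hg : MemLp g 2 (gibbsMeasure V)) (ψ : EuclideanSpace ℝ (Fin n) → ℝ) :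
    ∫ x, (hg.toLp g) x * ψ x = ∫ x, g x * ψ x := by
  refine integral_congr_ae ?_
  filter_upwards [(volume_absolutelyContinuous_gibbsMeasure hV).ae_le hg.coeFn_toLp] with x hx
  rw [hx]

theorem integral_smoothCompactToLp_mul_pderiv_pderiv (hV : ContDiff ℝ 2 V)
    (φ : smoothCompact n) {ψ : EuclideanSpace ℝ (Fin n) → ℝ} (hψ : ContDiff ℝ 2 ψ) (i j : Fin n) :
    ∫ x, smoothCompactToLp hV φ x * pderiv i (pderiv j ψ) x =
      ∫ x, hessianToLp hV i j φ x * ψ x := by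
  have h1 : ∫ x, smoothCompactToLp hV φ x * pderiv i (pderiv j ψ) x = _ :=
    integral_toLp_mul hV.continuous
      (memLp_gibbsMeasure hV.continuous φ.2.1.continuous φ.2.2) _
  have h2 : ∫ x, hessianToLp hV i j φ x * ψ x = _ :=
    integral_toLp_mul hV.continuous (memLp_pderiv_pderiv hV φ i j) ψ
  have hφ := smoothCompact_contDiff φ.2 2
  have hφ' : ContDiff ℝ 1 (pderiv i φ.1) := hφ.pderiv (by norm_num) i
  have h3 := integral_pderiv_mul (i := i) (hφ.of_le (by norm_num))
    (hψ.pderiv (l := 1) (by norm_num) j) φ.2.2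
  have h4 := integral_pderiv_mul (i := j) hφ' (hψ.of_le (by norm_num)) (φ.2.2.pderiv i)
  rw [h1, h2, show pderiv i (pderiv j φ.1) = pderiv j (pderiv i φ.1) from
    funext fun x => pderiv_comm hφ]
  linarith

end Closure

theorem mainTheorem7 (n : ℕ) (V : EuclideanSpace ℝ (Fin n) → ℝ) (hV : ContDiff ℝ 2 V)
    (hμ : IsProbabilityMeasure (gibbsMeasure V)) (C_P κ : ℝ) (hκ : 0 ≤ κ)
    (hP : SatisfiesPoincare (gibbsMeasure V) C_P) (hsc : IsSemiConvex V κ)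
    (f : (laplaceOperator hV).domain) :
    ∃ H : EuclideanSpace ℝ (Fin n) → Matrix (Fin n) (Fin n) ℝ,
      HasWeakHessian (f : Lp ℝ 2 (gibbsMeasure V)) H ∧
      (∀ i j, MemLp (fun x => H x i j) 2 (gibbsMeasure V)) ∧
      ∫ x, frobeniusSq (H x) ∂(gibbsMeasure V) ≤
        (1 + κ * C_P) * ∫ x, (laplaceOperator hV f x) ^ 2 ∂(gibbsMeasure V) := by
  obtain ⟨u, huf, huL⟩ := exists_smoothCompact_tendsto hV f
  -- Each Hessian entry is the `L²(μ)` limit of `∂ᵢ∂ⱼ u_k`, which is Cauchy because `L u_k`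
  -- converges.
  choose H hH using fun i j => cauchySeq_tendsto_of_complete
    (cauchySeq_map_of_norm_le (norm_hessianToLp_le hV hκ hP hsc i j) huL.cauchySeq)
  refine ⟨fun x => Matrix.of fun i j => H i j x,
    ⟨locallyIntegrable_of_gibbsMeasure hV.continuous f.1, fun i j =>
      ⟨locallyIntegrable_of_gibbsMeasure hV.continuous (H i j), fun φ hφ => ?_⟩⟩,
    fun i j => Lp.memLp (H i j), ?_⟩
  · have hφ2 := smoothCompact_contDiff hφ 2
    simp only [iteratedFDeriv_two_single hφ2, Matrix.of_apply]
    have hcont := ((hφ2.pderiv (l := 1) (by norm_num) j).pderiv (l := 0) (by norm_num) i).continuous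
    refine tendsto_nhds_unique
      (tendsto_integral_mul hV.continuous hcont ((hφ.2.pderiv j).pderiv i) huf) ?_
    simp only [integral_smoothCompactToLp_mul_pderiv_pderiv hV _ hφ2]
    exact tendsto_integral_mul hV.continuous hφ.1.continuous hφ.2 (hH i j)
  -- Convergence is strong, so the squared norms pass to the limit on both sides with the sharp
  -- constant intact.
  · have hle := le_of_tendsto_of_tendsto'
      (tendsto_finsetSum Finset.univ fun i _ => tendsto_finsetSum Finset.univ fun j _ =>
        ((hH i j).norm.pow 2))
      ((huL.norm.pow 2).const_mul (1 + κ * C_P))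
      fun k => sum_norm_hessianToLp_sq_le hV hκ hP hsc (u k)
    simp only [norm_Lp_sq] at hle
    refine le_trans (le_of_eq ?_) hle
    simp only [frobeniusSq, Matrix.of_apply]
    rw [integral_finsetSum _ fun i _ => integrable_finsetSum _ fun j _ =>
      (Lp.memLp (H i j)).integrable_sq]
    exact Finset.sum_congr rfl fun i _ => integral_finsetSum _ fun j _ =>
      (Lp.memLp (H i j)).integrable_sq
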